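/- Let $B\ge 1$ be an integer, $\tau\in(0,1)$, $\alpha>0$ and $0\le c\le 1$. In the problem $\mathtt{AdvMonotonicNBS}(\tau,\alpha,c)$ there are unknown numbers $0=p_0\le p_1\le\dots\le p_B=1$. An index $i\in\{0,\dots,B-1\}$ is called $(\tau,r)$-good if $[p_i,p_{i+1}]\cap(\tau-r,\tau+r)\neq\emptyset$. An algorithm adaptively picks coins $j\in\{1,\dots,B\}$; each time, an adaptive adversary, who knows the algorithm and everything that has happened so far, selects a probability $\tilde p\in[0,1]$ with $|\tilde p-p_j|\le c\alpha$, and the algorithm observes a coin flip with heads probability $\tilde p$. At the end the algorithm has to return a $(\tau,\alpha(1+c))$-good index. The algorithm solves the problem with probability at least $1-\beta$ if for all $(p_i)$ and all adversaries it returns such an index with probability at least $1-\beta$. Let $$C_{\tau,\alpha}=\max_{q\in[0,1]}\Big(H\big((1-q)(\tau-\alpha)+q(\tau+\alpha)\big)-(1-q)H(\tau-\alpha)-qH(\tau+\alpha)\Big),$$ where $H$ is the binary entropy function, with logarithms taken to the same base as below (the bounds do not depend on the base). (1) For every $\lambda>0$ there is a constant $K$, depending only on $\lambda$, such that for all $B\ge1$,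 $0<\alpha\le\frac14$ and $0\le c\le1$ there is an algorithm for $\mathtt{AdvMonotonicNBS}(1/2,\alpha,c)$ that uses at most $K\,\frac{\log B}{\alpha^2}$ coin flips and returns a $(1/2,\alpha(1+c))$-good index with probability at least $1-B^{-\lambda}$. (2) For every $\beta_0<1$ there is a constant $K$, depending only on $\beta_0$, such that for all $B\ge1$, $\tau\in(0,1)$, $0<\alpha\le\frac12\min\{\tau,1-\tau\}$, $0\le c\le1$ and $0<\beta\le\beta_0$ there is an algorithm for $\mathtt{AdvMonotonicNBS}(\tau,\alpha,c)$ that uses at most $$\frac1{C_{\tau,\alpha}}\Big(\log B+K\big(\log^{2/3}B\,\log^{1/3}\tfrac1\beta+\log\tfrac1\beta\big)\Big)$$ coin flips and returns a $(\tau,\alpha(1+c))$-good index with probability at least $1-\beta$. (3) $C_{\tau,\alpha}=\Theta\big(\frac{\alpha^2}{\tau(1-\tau)}\big)$ uniformly over $\tau\in(0,1)$ and $0<\alpha\le\frac12\min\{\tau,1-\tau\}$. -/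

import Mathlib

open scoped ENNReal

noncomputable section

namespace AdvNBS

/-- Head probabilities `p 0, p 1, …, p B` of the coins, with
`0 = p 0 ≤ p 1 ≤ ⋯ ≤ p B = 1`. -/
structure IsInstance {B : ℕ} (p : Fin (B + 1) → ℝ) : Prop where
  mono : Monotone p
  first : p 0 = 0
  last : p (Fin.last B) = 1

/-- The index `i ∈ {0, …, B - 1}` is `(τ, r)`-good if the interval `[p i, p (i+1)]`
meets `(τ - r, τ + r)`. -/
def IsGood {B : ℕ} (p : Fin (B + 1) → ℝ) (τ r : ℝ) (i : Fin B) : Prop :=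
  (Set.Icc (p i.castSucc) (p i.succ) ∩ Set.Ioo (τ - r) (τ + r)).Nonempty

/-- A (deterministic, adaptive) search algorithm on `B` coins making `flips` coin flips.
Histories are lists of flip outcomes (`true` is heads), most recent first.
After the history `h`, the next coin flipped is the one with index `query h + 1 ∈ {1, …, B}`
(so `j : Fin B` names the coin of head probability `p j.succ`);
after `flips` flips the index `output h ∈ {0, …, B - 1}` is returned.
As the algorithm is deterministic, a history also determines the coins flipped so far. -/
structure Algorithm (B : ℕ) where
  flips : ℕ
  query : List Bool → Fin B
  output : List Bool → Fin B

/-- An adaptive adversary: knowing the history `h` and the coin `j` picked by the algorithm,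
it selects the head probability of the coin that is actually flipped. -/
abbrev Adversary (B : ℕ) := List Bool → Fin B → unitInterval

/-- The adversary never moves a head probability by more than `δ`. -/
def Adversary.IsBounded {B : ℕ} (adv : Adversary B) (p : Fin (B + 1) → ℝ) (δ : ℝ) : Prop :=
  ∀ (h : List Bool) (j : Fin B), |(adv h j : ℝ) - p j.succ| ≤ δ

/-- A coin flip with head probability `x`. -/
def coinFlip (x : unitInterval) : PMF Bool :=
  PMF.ofFintype
    (fun b => ((cond b (unitInterval.toNNReal x) (unitInterval.toNNReal (unitInterval.symm x)) :
      NNReal) : ℝ≥0∞))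
    (by rw [Fintype.sum_bool, ← ENNReal.coe_add]; simp)

/-- The law of the history after `t` flips. -/
def Algorithm.history {B : ℕ} (A : Algorithm B) (adv : Adversary B) : ℕ → PMF (List Bool)
  | 0 => PMF.pure []
  | t + 1 => (A.history adv t).bind fun h =>
      (coinFlip (adv h (A.query h))).map fun b => b :: h

/-- The law of the returned index. -/
def Algorithm.outputLaw {B : ℕ} (A : Algorithm B) (adv : Adversary B) : PMF (Fin B) :=
  (A.history adv A.flips).map A.output

/-- `A` solves adversarial monotonic noisy binary search with target `τ`, error `α` and
perturbation parameter `c`, with failure probability at most `β`: whatever the coins and the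
adversary are, the returned index is `(τ, α (1 + c))`-good with probability at least `1 - β`. -/
def Algorithm.Solves {B : ℕ} (A : Algorithm B) (τ α c β : ℝ) : Prop :=
  ∀ p : Fin (B + 1) → ℝ, IsInstance p →
    ∀ adv : Adversary B, adv.IsBounded p (c * α) →
      ENNReal.ofReal (1 - β) ≤
        (A.outputLaw adv).toOuterMeasure {i | IsGood p τ (α * (1 + c)) i}

/-- The capacity of the binary asymmetric channel with crossover probabilities `τ - α`, `τ + α`.
It is measured in nats; the ratio of `log B` and the capacity is the same for every base of
the logarithm. -/
def capacity (τ α : ℝ) : ℝ :=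
  sSup ((fun q : ℝ => Real.binEntropy ((1 - q) * (τ - α) + q * (τ + α))
    - (1 - q) * Real.binEntropy (τ - α) - q * Real.binEntropy (τ + α)) '' Set.Icc 0 1)

end AdvNBS

end

noncomputable section

namespace AdvNBS

/-! The search is Bayesian learning over a noisy channel. Index `k` stands for the hypothesis that
the coins up to `k` have head probability `a = τ - α` and the later ones `b = τ + α`. Let `s` be the
law with `kl a s = kl b s`; this common value is the capacity `C`, and `s` is the output law
achieving it. The learner flips a coin bounding the index that contains the `q`-quantile of its
weights, and lets that one index predict a mixture of `a` and `b`, so that the mean prediction is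
exactly `s`. Likelihood ratios against `s` then keep the total weight equal to one, and no index can
ever gain more than `log B`. A hypothesis confirmed on every flip would gain about `C` per flip,
whence the leading term `log B / C`.

The first difficulty is the adversary. The good indices contain an interval `[l, r]` such that coins
up to `l` are low (at most `a`) and coins above `r` are high (at least `b`), but the coins in
between behave arbitrarily, so no single index need be right. The statistics are therefore
one-sided: `RightOK` holds for `r` and `LeftOK` for `l` with high probability, by exponential
supermartingales. Suppose `RightOK` holds for `k` and `LeftOK` for some `k' > k`. The flips of the
coins between them cannot favour both `a` and `b` over `s` (`cum_midGain_le`), so `k` or `k'` would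
gain more than `log B`, unless it lost at least `thr` by being split (`defect_of_disjoint`).

The second difficulty is this loss. A large `lowDefect i` is evidence that coin `i` is not high, so
that `i ≤ r`; a large `highDefect i` is evidence that coin `i + 1` is not low, so that `l ≤ i`. Only
one defect moves per flip and `penalty` vanishes at zero, so the sum of the penalties over all wrong
indices has drift `O(C)` per flip, and Markov's inequality excludes all false certificates at once
without a factor `B` (`prob_lowSet_le`, `prob_highSet_le`). Two short likelihood-ratio tests, of the
coin above the largest certified-low index `top` and of the coin at the smallest certified-high
index `bot`, tell whether one of these indices can be returned. If not, the least `RightOK` index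
beyond the certified-low ones lies in `[l, r]` (`answer_mem`).

Tuning in `exists_parameters` gives the bound by capacity; the bound for fair coins is its case `β =
B ^ (-λ)`, and the size of the capacity is part of `exists_channel`. -/

/-- The probability of the outcome `c` of a coin flip with head probability `x`. -/
def bern (x : ℝ) (c : Bool) : ℝ := cond c x (1 - x)

/-- The mean of `G` over the outcome of a coin flip with head probability `p`. -/
def mean (p : ℝ) (G : Bool → ℝ) : ℝ := p * G true + (1 - p) * G false

/-- The relative entropy of Bernoulli laws. -/
def kl (p s : ℝ) : ℝ := p * Real.log (p / s) + (1 - p) * Real.log ((1 - p) / (1 - s))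

@[simp] lemma bern_true (x : ℝ) : bern x true = x := rfl
@[simp] lemma bern_false (x : ℝ) : bern x false = 1 - x := rfl

lemma bern_pos {x : ℝ} (h0 : 0 < x) (h1 : x < 1) (c : Bool) : 0 < bern x c := by
  cases c <;> simp <;> linarith

lemma mean_mono {p : ℝ} (h0 : 0 ≤ p) (h1 : p ≤ 1) {F G : Bool → ℝ} (h : ∀ c, F c ≤ G c) :
    mean p F ≤ mean p G := by
  unfold mean
  have := mul_le_mul_of_nonneg_left (h true) h0
  have := mul_le_mul_of_nonneg_left (h false) (sub_nonneg.2 h1)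
  linarith

/-! ### Relative entropy of Bernoulli laws: upper and lower estimates -/

lemma mul_log_div_ge {x y : ℝ} (hx : 0 ≤ x) (hy : 0 < y) : x - y ≤ x * Real.log (x / y) := by
  rcases hx.eq_or_lt with rfl | hx
  · simp [hy.le]
  have h := Real.one_sub_inv_le_log_of_pos (div_pos hx hy)
  have h2 := mul_le_mul_of_nonneg_left h hx.le
  have h3 : x * (1 - (x / y)⁻¹) = x - y := by field_simp
  linarith

lemma kl_nonneg {p s : ℝ} (hp0 : 0 ≤ p) (hp1 : p ≤ 1) (hs0 : 0 < s) (hs1 : s < 1) :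
    0 ≤ kl p s := by
  have h1 := mul_log_div_ge hp0 hs0
  have h2 := mul_log_div_ge (sub_nonneg.2 hp1) (sub_pos.2 hs1)
  unfold kl; linarith

lemma mul_log_div_le {x y : ℝ} (hx : 0 < x) (hy : 0 < y) : x * Real.log (x / y) ≤ x * (x - y) / y := by
  have h := Real.log_le_sub_one_of_pos (div_pos hx hy)
  have h2 := mul_le_mul_of_nonneg_left h hx.le
  have h3 : x * (x / y - 1) = x * (x - y) / y := by field_simp
  linarith

/-- The relative entropy is at most the chi-square divergence. -/
lemma kl_le_chi_sq {p s : ℝ} (hp0 : 0 < p) (hp1 : p < 1) (hs0 : 0 < s) (hs1 : s < 1) :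
    kl p s ≤ (p - s) ^ 2 / (s * (1 - s)) := by
  have h1 := mul_log_div_le hp0 hs0
  have h2 := mul_log_div_le (sub_pos.2 hp1) (sub_pos.2 hs1)
  have hs : (0:ℝ) < 1 - s := sub_pos.2 hs1
  have : p * (p - s) / s + (1 - p) * (1 - p - (1 - s)) / (1 - s)
      = (p - s) ^ 2 / (s * (1 - s)) := by
    field_simp; ring
  unfold kl; linarith

lemma sqrt_mul_le {x y : ℝ} (hx : 0 < x) (hy : 0 < y) :
    √(x * y) ≤ (x + y) / 2 - (x - y) ^ 2 / (4 * (x + y)) := by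
  have e : (x + y) / 2 - (x - y) ^ 2 / (4 * (x + y))
      = (x ^ 2 + 6 * x * y + y ^ 2) / (4 * (x + y)) := by
    field_simp; ring
  rw [e]
  apply Real.sqrt_le_iff.2 ⟨by positivity, ?_⟩
  rw [div_pow, le_div_iff₀ (by positivity)]
  -- The two sides differ by exactly `(x - y) ^ 4`.
  nlinarith [sq_nonneg ((x - y) ^ 2)]

/-- This is `log u ≤ u - 1` at `u = √(y / x)`. Summed over both outcomes, it bounds relative entropy
below by a squared Hellinger distance. -/
lemma neg_two_sqrt_le_mul_log {x y : ℝ} (hx : 0 < x) (hy : 0 < y) :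
    2 * x - 2 * √(x * y) ≤ x * Real.log (x / y) := by
  have hq : 0 < √(y / x) := Real.sqrt_pos.2 (by positivity)
  have h := Real.log_le_sub_one_of_pos hq
  rw [Real.log_sqrt (by positivity)] at h
  have e : √(x * y) = x * √(y / x) := by
    have : x * y = x ^ 2 * (y / x) := by field_simp
    rw [this, Real.sqrt_mul (by positivity), Real.sqrt_sq hx.le]
  have e2 : Real.log (x / y) = - Real.log (y / x) := by
    rw [← Real.log_inv, inv_div]
  rw [e, e2]
  nlinarith

lemma kl_ge {p s : ℝ} (hp0 : 0 < p) (hp1 : p < 1) (hs0 : 0 < s) (hs1 : s < 1) :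
    (p - s) ^ 2 / 2 * (1 / (p + s) + 1 / (2 - p - s)) ≤ kl p s := by
  have h1 := neg_two_sqrt_le_mul_log hp0 hs0
  have h2 := neg_two_sqrt_le_mul_log (sub_pos.2 hp1) (sub_pos.2 hs1)
  have h3 := sqrt_mul_le hp0 hs0
  have h4 := sqrt_mul_le (sub_pos.2 hp1) (sub_pos.2 hs1)
  have e4 : (1 - p - (1 - s)) ^ 2 / (4 * (1 - p + (1 - s)))
      = (p - s) ^ 2 / 4 * (1 / (2 - p - s)) := by
    have : (2 - p - s) ≠ 0 := by linarith
    have e : 1 - p + (1 - s) = 2 - p - s := by ring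
    rw [e]; field_simp; ring
  have e3 : (p - s) ^ 2 / (4 * (p + s)) = (p - s) ^ 2 / 4 * (1 / (p + s)) := by
    field_simp
  rw [e3] at h3; rw [e4] at h4
  unfold kl; linarith

/-! ### Capacity of the two-point channel -/

/-- The two-point channel with head probabilities `a < b`, its capacity `C` and the head
probability `s` of its capacity-achieving output law, with the quantitative estimates
on which noisy binary search relies. -/
structure Channel (a b s C : ℝ) : Prop where
  a_pos : 0 < a
  a_lt : a < s
  lt_b : s < b
  b_lt : b < 1
  C_pos : 0 < C
  C_le : C ≤ 4
  kl_a : kl a s = C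
  kl_b : kl b s = C
  abs_a : ∀ c, |Real.log (bern a c / bern s c)| ≤ 2
  abs_b : ∀ c, |Real.log (bern b c / bern s c)| ≤ 2
  var_a : mean a (fun c => Real.log (bern a c / bern s c) ^ 2) ≤ 144 * C
  var_b : mean b (fun c => Real.log (bern b c / bern s c) ^ 2) ≤ 144 * C
  kl_ab : kl a b ≤ 48 * C
  kl_ba : kl b a ≤ 48 * C
  affinity : √(a * b) + √((1 - a) * (1 - b)) ≤ Real.exp (-(C / 32))

/-- Intermediate value theorem: `kl a s - kl b s` is negative at `s = a` and positive at `s = b`. -/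
lemma exists_kl_eq {a b : ℝ} (ha : 0 < a) (hab : a < b) (hb : b < 1) :
    ∃ s, a < s ∧ s < b ∧ kl a s = kl b s := by
  have hc : ∀ p, p ≠ 0 → p ≠ 1 → ContinuousOn (fun s => kl p s) (Set.Icc a b) := by
    intro p hp0 hp1
    simp only [kl]
    refine ContinuousOn.add (continuousOn_const.mul ?_) (continuousOn_const.mul ?_)
    · refine ContinuousOn.log ?_ ?_
      · exact continuousOn_const.div (by fun_prop) (fun x hx => by
          have := hx.1; intro h; linarith)
      · intro x hx; have := hx.1
        exact div_ne_zero hp0 (by linarith)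
    · refine ContinuousOn.log ?_ ?_
      · exact continuousOn_const.div (by fun_prop) (fun x hx => by
          have := hx.2; intro h; linarith)
      · intro x hx; have := hx.2
        exact div_ne_zero (sub_ne_zero.2 (Ne.symm hp1)) (by linarith)
  have hself : ∀ p, 0 < p → p < 1 → kl p p = 0 := by
    intro p h0 h1
    have : (1 - p) ≠ 0 := by linarith
    simp [kl, div_self h0.ne', div_self this]
  have hpos : ∀ p s, 0 < p → p < 1 → 0 < s → s < 1 → p ≠ s → 0 < kl p s := by
    intro p s h0 h1 h2 h3 hne
    refine lt_of_lt_of_le ?_ (kl_ge h0 h1 h2 h3)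
    have : 0 < (p - s) ^ 2 := by
      have := sub_ne_zero.2 hne; positivity
    have h5 : 0 < p + s := by linarith
    have h6 : 0 < 2 - p - s := by linarith
    positivity
  have hcont : ContinuousOn (fun s => kl a s - kl b s) (Set.Icc a b) := 
    (hc a (by linarith) (by linarith)).sub (hc b (by linarith) (by linarith))
  have hb0 : 0 < b := ha.trans hab
  have ha1 : a < 1 := hab.trans hb
  have h0 : (0:ℝ) ∈ Set.Ioo (kl a a - kl b a) (kl a b - kl b b) := by
    rw [hself a ha ha1, hself b hb0 hb]
    have := hpos b a hb0 hb ha ha1 hab.ne'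
    have := hpos a b ha ha1 hb0 hb hab.ne
    constructor <;> linarith
  obtain ⟨s, hs, h⟩ := intermediate_value_Ioo hab.le hcont h0
  exact ⟨s, hs.1, hs.2, by simpa [sub_eq_zero] using h⟩

/-- The compensation identity: replacing the true output law by an arbitrary reference `s`
overestimates the mutual information by the relative entropy of the output law from `s`. -/
lemma mutual_information_eq {a b s q : ℝ} (ha : 0 < a) (hab : a < b) (hb : b < 1)
    (hs0 : 0 < s) (hs1 : s < 1) (hq0 : 0 ≤ q) (hq1 : q ≤ 1) :
    Real.binEntropy ((1 - q) * a + q * b) - (1 - q) * Real.binEntropy a - q * Real.binEntropy b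
      = (1 - q) * kl a s + q * kl b s - kl ((1 - q) * a + q * b) s := by
  have hm0 : 0 < (1 - q) * a + q * b := by nlinarith
  have hm1 : 0 < 1 - ((1 - q) * a + q * b) := by nlinarith
  have h1 : (1 - a) ≠ 0 := by linarith
  have h2 : (1 - b) ≠ 0 := by linarith
  have h3 : (1 - s) ≠ 0 := by linarith
  have hb0 : b ≠ 0 := by linarith
  unfold kl Real.binEntropy
  rw [Real.log_div ha.ne' hs0.ne', Real.log_div hb0 hs0.ne', Real.log_div hm0.ne' hs0.ne',
    Real.log_div h1 h3, Real.log_div h2 h3, Real.log_div hm1.ne' h3]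
  simp only [Real.log_inv]
  ring

/-- With `s` equidistant from both inputs, the mutual information is `kl (τ - α) s` minus a relative
entropy, which vanishes exactly when the output law is `s`. -/
lemma capacity_eq_kl {τ α s : ℝ} (ha : 0 < τ - α) (hα : 0 < α) (hb : τ + α < 1)
    (hs0 : τ - α < s) (hs1 : s < τ + α) (h : kl (τ - α) s = kl (τ + α) s) :
    capacity τ α = kl (τ - α) s := by
  have hab : τ - α < τ + α := by linarith
  unfold capacity
  refine IsGreatest.csSup_eq ⟨?_, ?_⟩
  · have hd : 0 < 2 * α := by linarith
    refine ⟨(s - (τ - α)) / (2 * α), ⟨by apply div_nonneg <;> linarith, ?_⟩, ?_⟩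
    · rw [div_le_one hd]; linarith
    · have hq0 : 0 ≤ (s - (τ - α)) / (2 * α) := by apply div_nonneg <;> linarith
      have hq1 : (s - (τ - α)) / (2 * α) ≤ 1 := by rw [div_le_one hd]; linarith
      have := mutual_information_eq ha hab hb (ha.trans hs0) (hs1.trans hb) hq0 hq1
      simp only
      rw [this]
      have e : (1 - (s - (τ - α)) / (2 * α)) * (τ - α) + (s - (τ - α)) / (2 * α) * (τ + α) = s := by
        field_simp; ring
      rw [e, ← h]
      have h1 : (1 - s) ≠ 0 := by linarith
      have h0 : s ≠ 0 := by linarith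
      have : kl s s = 0 := by simp [kl, div_self h0, div_self h1]
      rw [this]; ring
  · rintro _ ⟨q, ⟨hq0, hq1⟩, rfl⟩
    simp only
    rw [mutual_information_eq ha hab hb (ha.trans hs0) (hs1.trans hb) hq0 hq1, ← h]
    have := kl_nonneg (p := (1 - q) * (τ - α) + q * (τ + α)) (s := s) (by nlinarith) (by nlinarith)
      (ha.trans hs0) (hs1.trans hb)
    nlinarith

lemma abs_log_div_le {x y m : ℝ} (hm : 0 < m) (hx : m ≤ x) (hy : m ≤ y) :
    |Real.log (x / y)| ≤ |x - y| / m := by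
  have hx0 := hm.trans_le hx
  have hy0 := hm.trans_le hy
  have h1 := Real.log_le_sub_one_of_pos (div_pos hx0 hy0)
  have h2 := Real.one_sub_inv_le_log_of_pos (div_pos hx0 hy0)
  have e1 : x / y - 1 = (x - y) / y := by field_simp
  have e2 : 1 - (x / y)⁻¹ = (x - y) / x := by field_simp
  rw [e1] at h1; rw [e2] at h2
  have b1 : (x - y) / y ≤ |x - y| / m :=
    div_le_div₀ (abs_nonneg _) (le_abs_self _) hm hy
  have b2 : -(|x - y| / m) ≤ (x - y) / x := by
    have : (y - x) / x ≤ |x - y| / m :=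
      div_le_div₀ (abs_nonneg _) (by rw [abs_sub_comm]; exact le_abs_self _) hm hx
    have e : (x - y) / x = -((y - x) / x) := by ring
    linarith
  exact abs_le.2 ⟨by linarith, by linarith⟩

lemma var_le {x y M d m : ℝ} (hm : 0 < m) (hx : m ≤ x) (hy : m ≤ y) (hM : x ≤ M)
    (hd : |x - y| ≤ d) : x * Real.log (x / y) ^ 2 ≤ M * (d / m) ^ 2 := by
  have h := (abs_log_div_le hm hx hy).trans (div_le_div_of_nonneg_right hd hm.le)
  have h2 : Real.log (x / y) ^ 2 ≤ (d / m) ^ 2 := by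
    rw [← sq_abs]; exact pow_le_pow_left₀ (abs_nonneg _) h 2
  have : 0 ≤ x := by linarith
  have : 0 ≤ M := by linarith
  gcongr

/-- As `α` is at most half of `τ` and of `1 - τ`, all head probabilities and their complements stay
within constant factors of `τ` and `1 - τ`, so everything compares with `v = α ^ 2 / (τ (1 - τ))`:
the capacity lies in `[v / 6, 16 v]`, the second moments are at most `24 v ≤ 144 C`, the entropies
between `a` and `b` at most `8 v ≤ 48 C`, and the affinity at most `1 - v / 2 ≤ 1 - C / 32`. -/
lemma exists_channel {τ α : ℝ} (hτ0 : 0 < τ) (hτ1 : τ < 1) (hα : 0 < α)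
    (hατ : α ≤ 1 / 2 * min τ (1 - τ)) :
    (∃ s, Channel (τ - α) (τ + α) s (capacity τ α)) ∧
      1 / 6 * (α ^ 2 / (τ * (1 - τ))) ≤ capacity τ α ∧
      capacity τ α ≤ 16 * (α ^ 2 / (τ * (1 - τ))) := by
  have hm1 : α ≤ τ / 2 := by have := min_le_left τ (1 - τ); linarith
  have hm2 : α ≤ (1 - τ) / 2 := by have := min_le_right τ (1 - τ); linarith
  have ha : 0 < τ - α := by linarith
  have hb : τ + α < 1 := by linarith
  have h1τ : 0 < 1 - τ := by linarith
  obtain ⟨s, hs0, hs1, hkl⟩ := exists_kl_eq ha (by linarith : τ - α < τ + α) hb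
  have hC := capacity_eq_kl ha hα hb hs0 hs1 hkl
  have hs0' := ha.trans hs0
  have hs1' := hs1.trans hb
  set v := α ^ 2 / (τ * (1 - τ)) with hv
  have hv0 : 0 < v := by positivity
  have hvadd : v = α ^ 2 / τ + α ^ 2 / (1 - τ) := by rw [hv]; field_simp; ring
  have hv4 : v ≤ 1 / 4 := by
    rw [hv, div_le_iff₀ (by positivity)]
    nlinarith [mul_le_mul hm1 hm2 hα.le (by linarith)]
  -- lower bound
  have low : 1 / 6 * v ≤ capacity τ α := by
    -- At least one endpoint is at distance `α` or more from `s`. The factor `1 / 6` comes from `p +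
    -- s ≤ 3 τ` and `2 - p - s ≤ 3 (1 - τ)`.
    have key : ∀ p, τ - α ≤ p → p ≤ τ + α → α ^ 2 ≤ (p - s) ^ 2 → 1 / 6 * v ≤ kl p s := by
      intro p hp0 hp1 hps
      refine le_trans ?_ (kl_ge (by linarith) (by linarith) hs0' hs1')
      have e1 : 1 / (3 * τ) ≤ 1 / (p + s) := one_div_le_one_div_of_le (by linarith) (by linarith)
      have e2 : 1 / (3 * (1 - τ)) ≤ 1 / (2 - p - s) :=
        one_div_le_one_div_of_le (by linarith) (by linarith)
      have e3 : 1 / 6 * v = α ^ 2 / 2 * (1 / (3 * τ) + 1 / (3 * (1 - τ))) := by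
        rw [hv]; field_simp; ring
      rw [e3]
      gcongr
    rcases le_total s τ with h | h
    · rw [hC, hkl]; exact key _ (by linarith) le_rfl (by nlinarith)
    · rw [hC]; exact key _ le_rfl (by linarith) (by nlinarith)
  have ss : τ / 2 * ((1 - τ) / 2) ≤ s * (1 - s) :=
    mul_le_mul (by linarith) (by linarith) (by linarith) hs0'.le
  have up : capacity τ α ≤ 16 * v := by
    rw [hC]
    refine (kl_le_chi_sq ha (by linarith) hs0' hs1').trans ?_
    have : (τ - α - s) ^ 2 ≤ (2 * α) ^ 2 := by nlinarith
    have e : 16 * v = (2 * α) ^ 2 / (τ / 2 * ((1 - τ) / 2)) := by rw [hv]; field_simp; ring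
    rw [e]
    gcongr
  refine ⟨⟨s, ?_⟩, low, up⟩
  have habs : ∀ y, τ - α ≤ y → y ≤ τ + α → ∀ c, |Real.log (bern y c / bern s c)| ≤ 2 := by
    intro y hy0 hy1 c
    cases c
    · refine (abs_log_div_le (m := (1 - τ) / 2) (by linarith) (by simp; linarith)
        (by simp; linarith)).trans ?_
      rw [div_le_iff₀ (by linarith)]
      simp only [bern_false]
      rw [abs_le]; constructor <;> linarith
    · refine (abs_log_div_le (m := τ / 2) (by linarith) (by simp; linarith)
        (by simp; linarith)).trans ?_
      rw [div_le_iff₀ (by linarith)]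
      simp only [bern_true]
      rw [abs_le]; constructor <;> linarith
  have hvar : ∀ y, τ - α ≤ y → y ≤ τ + α →
      mean y (fun c => Real.log (bern y c / bern s c) ^ 2) ≤ 144 * capacity τ α := by
    intro y hy0 hy1
    have h1 := var_le (x := y) (y := s) (M := 3 / 2 * τ) (d := 2 * α) (m := τ / 2)
      (by linarith) (by linarith) (by linarith) (by linarith)
      (by rw [abs_le]; constructor <;> linarith)
    have h2 := var_le (x := 1 - y) (y := 1 - s) (M := 3 / 2 * (1 - τ)) (d := 2 * α)
      (m := (1 - τ) / 2) (by linarith) (by linarith) (by linarith) (by linarith)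
      (by rw [abs_le]; constructor <;> linarith)
    have e1 : 3 / 2 * τ * (2 * α / (τ / 2)) ^ 2 = 24 * (α ^ 2 / τ) := by field_simp; ring
    have e2 : 3 / 2 * (1 - τ) * (2 * α / ((1 - τ) / 2)) ^ 2 = 24 * (α ^ 2 / (1 - τ)) := by
      field_simp; ring
    unfold mean
    simp only [bern_true, bern_false]
    linarith
  refine ⟨ha, hs0, hs1, hb, by linarith, by linarith, hC.symm, by rw [hC, hkl],
    habs _ le_rfl (by linarith), habs _ (by linarith) le_rfl, hvar _ le_rfl (by linarith),
    hvar _ (by linarith) le_rfl, ?_, ?_, ?_⟩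
  · refine (kl_le_chi_sq ha (by linarith) (by linarith) hb).trans ?_
    have e : (τ - α - (τ + α)) ^ 2 / (τ * ((1 - τ) / 2)) = 8 * v := by rw [hv]; field_simp; ring
    have : (τ - α - (τ + α)) ^ 2 / ((τ + α) * (1 - (τ + α))) ≤
        (τ - α - (τ + α)) ^ 2 / (τ * ((1 - τ) / 2)) := by
      apply div_le_div_of_nonneg_left (by positivity) (by positivity)
      exact mul_le_mul (by linarith) (by linarith) (by linarith) (by linarith)
    linarith
  · refine (kl_le_chi_sq (by linarith) hb ha (by linarith)).trans ?_
    have e : (τ + α - (τ - α)) ^ 2 / (τ / 2 * (1 - τ)) = 8 * v := by rw [hv]; field_simp; ring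
    have : (τ + α - (τ - α)) ^ 2 / ((τ - α) * (1 - (τ - α))) ≤
        (τ + α - (τ - α)) ^ 2 / (τ / 2 * (1 - τ)) := by
      apply div_le_div_of_nonneg_left (by positivity) (by positivity)
      exact mul_le_mul (by linarith) (by linarith) (by linarith) (by linarith)
    linarith
  · have h1 := sqrt_mul_le ha (by linarith : 0 < τ + α)
    have h2 := sqrt_mul_le (by linarith : 0 < 1 - (τ - α)) (by linarith : 0 < 1 - (τ + α))
    have e1 : (τ - α + (τ + α)) / 2 - (τ - α - (τ + α)) ^ 2 / (4 * (τ - α + (τ + α)))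
        = τ - α ^ 2 / τ / 2 := by
      have : τ - α + (τ + α) = 2 * τ := by ring
      rw [this]; field_simp; ring
    have e2 : (1 - (τ - α) + (1 - (τ + α))) / 2 - (1 - (τ - α) - (1 - (τ + α))) ^ 2 /
        (4 * (1 - (τ - α) + (1 - (τ + α)))) = (1 - τ) - α ^ 2 / (1 - τ) / 2 := by
      have : 1 - (τ - α) + (1 - (τ + α)) = 2 * (1 - τ) := by ring
      rw [this]; field_simp; ring
    rw [e1] at h1; rw [e2] at h2
    have := Real.add_one_le_exp (-(capacity τ α / 32))
    linarith

/-! ### One-step estimates -/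

/-- The mean is `1` at `p = y` and affine in `p`; the sign condition says that `p` lies beyond `y`
as seen from `s`, where it decreases. -/
lemma mean_div_le_one {p y s : ℝ} (hy0 : 0 < y) (hy1 : y < 1)
    (h : 0 ≤ (p - y) * (y - s)) : mean p (fun c => bern s c / bern y c) ≤ 1 := by
  have h1 : (0:ℝ) < 1 - y := by linarith
  have e : mean p (fun c => bern s c / bern y c) = 1 - (p - y) * (y - s) / (y * (1 - y)) := by
    simp only [mean, bern_true, bern_false]; field_simp; ring
  rw [e]
  have : 0 ≤ (p - y) * (y - s) / (y * (1 - y)) := by positivity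
  linarith

lemma exp_mul_log_le {x t : ℝ} (hx : 0 < x) (h0 : 0 ≤ t) (h1 : t ≤ 1) :
    Real.exp (t * Real.log x) ≤ 1 + t * (x - 1) := by
  have := Real.geom_mean_le_arith_mean2_weighted h0 (sub_nonneg.2 h1) hx.le zero_le_one (by ring)
  rw [Real.one_rpow, Real.rpow_def_of_pos hx, mul_comm (Real.log x)] at this
  linarith

/-- Moving the head probability from `s` past `y` makes the tilted likelihood ratio a
supermartingale. -/
lemma mean_exp_neg_le_one {p y s t : ℝ} (hp0 : 0 ≤ p) (hp1 : p ≤ 1) (hy0 : 0 < y) (hy1 : y < 1)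
    (hs0 : 0 < s) (hs1 : s < 1) (h : 0 ≤ (p - y) * (y - s)) (ht0 : 0 ≤ t) (ht1 : t ≤ 1) :
    mean p (fun c => Real.exp (-(t * Real.log (bern y c / bern s c)))) ≤ 1 := by
  have h1 := mean_div_le_one hy0 hy1 h
  have h2 : mean p (fun c => Real.exp (-(t * Real.log (bern y c / bern s c)))) ≤
      mean p (fun c => 1 + t * (bern s c / bern y c - 1)) := by
    apply mean_mono hp0 hp1
    intro c
    have e : -(t * Real.log (bern y c / bern s c)) = t * Real.log (bern s c / bern y c) := by
      rw [← inv_div, Real.log_inv]; ring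
    rw [e]
    exact exp_mul_log_le (div_pos (bern_pos hs0 hs1 c) (bern_pos hy0 hy1 c)) ht0 ht1
  refine h2.trans ?_
  unfold mean at h1 ⊢
  nlinarith

/-- A tilt by a small `t` costs only a factor `1 - 144 t` of the capacity: the mean gain is `C`, and
the quadratic Taylor term is at most `144 C t ^ 2`. -/
lemma mean_exp_neg_le {p y s t C : ℝ} (hy0 : 0 < y) (hy1 : y < 1)
    (hs0 : 0 < s) (hs1 : s < 1) (h : 0 ≤ (p - y) * (y - s)) (hys : y ≠ s) (ht0 : 0 ≤ t)
    (ht1 : t ≤ 1 / 2) (hC : kl y s = C) (habs : ∀ c, |Real.log (bern y c / bern s c)| ≤ 2)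
    (hvar : mean y (fun c => Real.log (bern y c / bern s c) ^ 2) ≤ 144 * C) :
    mean p (fun c => Real.exp (-(t * Real.log (bern y c / bern s c)))) ≤
      Real.exp (-(t * (C * (1 - 144 * t)))) := by
  set X : Bool → ℝ := fun c => Real.log (bern y c / bern s c) with hX
  -- Moving `p` from `y` further away from `s` only favours the outcome with the larger
  -- log-likelihood ratio.
  have hmono : mean p (fun c => Real.exp (-(t * X c))) ≤ mean y (fun c => Real.exp (-(t * X c))) := by
    have e : mean y (fun c => Real.exp (-(t * X c))) - mean p (fun c => Real.exp (-(t * X c)))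
        = (p - y) * (Real.exp (-(t * X false)) - Real.exp (-(t * X true))) := by
      unfold mean; ring
    have : 0 ≤ (p - y) * (Real.exp (-(t * X false)) - Real.exp (-(t * X true))) := by
      rcases lt_or_gt_of_ne hys with hlt | hgt
      · have hp : p ≤ y := by
          by_contra hc; push Not at hc; nlinarith [mul_pos (sub_pos.2 hc) (sub_pos.2 hlt)]
        have h1 : X true ≤ 0 := Real.log_nonpos (by simp; positivity) (by
          simp only [bern_true]; rw [div_le_one hs0]; exact hlt.le)
        have h2 : 0 ≤ X false := Real.log_nonneg (by
          simp only [bern_false]; rw [le_div_iff₀ (by linarith)]; linarith)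
        have : Real.exp (-(t * X false)) ≤ Real.exp (-(t * X true)) := by
          apply Real.exp_le_exp.2; nlinarith
        nlinarith
      · have hp : y ≤ p := by
          by_contra hc; push Not at hc; nlinarith [mul_pos (sub_pos.2 hc) (sub_pos.2 hgt)]
        have h1 : 0 ≤ X true := Real.log_nonneg (by
          simp only [bern_true]; rw [le_div_iff₀ hs0]; linarith)
        have h2 : X false ≤ 0 := Real.log_nonpos (by
          simp only [bern_false]; apply div_nonneg <;> linarith) (by
          simp only [bern_false]; rw [div_le_one (by linarith)]; linarith)
        have : Real.exp (-(t * X true)) ≤ Real.exp (-(t * X false)) := by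
          apply Real.exp_le_exp.2; nlinarith
        nlinarith
    linarith
  refine hmono.trans ?_
  have h2 : mean y (fun c => Real.exp (-(t * X c))) ≤
      mean y (fun c => 1 - t * X c + t ^ 2 * X c ^ 2) := by
    apply mean_mono hy0.le hy1.le
    intro c
    have hb : |-(t * X c)| ≤ 1 := by
      rw [abs_neg, abs_mul, abs_of_nonneg ht0]
      have := habs c
      nlinarith [abs_nonneg (X c)]
    have := (abs_le.1 (Real.abs_exp_sub_one_sub_id_le hb)).2
    nlinarith
  have e : mean y (fun c => 1 - t * X c + t ^ 2 * X c ^ 2)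
      = 1 - t * kl y s + t ^ 2 * mean y (fun c => X c ^ 2) := by
    simp only [mean, kl, hX, bern_true, bern_false]; ring
  have h3 := Real.add_one_le_exp (-(t * (C * (1 - 144 * t))))
  rw [e, hC] at h2
  have h4 : t ^ 2 * mean y (fun c => X c ^ 2) ≤ t ^ 2 * (144 * C) := by gcongr
  nlinarith

/-- A convex increasing penalty which grows exponentially and vanishes on `(-∞, 0]`. -/
def penalty (x : ℝ) : ℝ := if 0 ≤ x then Real.exp x - 1 - x else 0

lemma penalty_nonneg (x : ℝ) : 0 ≤ penalty x := by
  unfold penalty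
  split_ifs
  · have := Real.add_one_le_exp x; linarith
  · exact le_rfl

lemma penalty_zero : penalty 0 = 0 := by simp [penalty]

lemma penalty_le (x : ℝ) : penalty x ≤ Real.exp x - 1 - x := by
  unfold penalty
  split_ifs
  · exact le_rfl
  · have := Real.add_one_le_exp x; linarith

lemma penalty_mono : Monotone penalty := by
  intro x y hxy
  unfold penalty
  split_ifs with h1 h2 h2
  · have h3 := Real.add_one_le_exp (y - x)
    have h4 : Real.exp y = Real.exp x * Real.exp (y - x) := by rw [← Real.exp_add]; ring_nf
    have h5 : 1 ≤ Real.exp x := Real.one_le_exp h1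
    nlinarith
  · linarith
  · have := Real.add_one_le_exp y; linarith
  · exact le_rfl

/-- One step of the penalised log-likelihood ratio of `z` against `y`, where the true head
probability `p` lies beyond `x`, on the other side of `y` than `z`. -/
lemma mean_penalty_le {p x y z e : ℝ} (hx0 : 0 < x) (hx1 : x < 1)
    (hy0 : 0 < y) (hy1 : y < 1) (hz0 : 0 < z) (hz1 : z < 1)
    (hxp : 0 ≤ (p - x) * (y - z)) (hxy : 0 ≤ (x - y) * (y - z)) :
    mean p (fun c => penalty (e + Real.log (bern z c / bern y c))) ≤ penalty e + kl x z := by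
  set δ : Bool → ℝ := fun c => Real.log (bern z c / bern y c) with hδ
  have hxle : mean p (fun c => penalty (e + δ c)) ≤ mean x (fun c => penalty (e + δ c)) := by
    have e1 : mean x (fun c => penalty (e + δ c)) - mean p (fun c => penalty (e + δ c))
        = (p - x) * (penalty (e + δ false) - penalty (e + δ true)) := by
      unfold mean; ring
    have : 0 ≤ (p - x) * (penalty (e + δ false) - penalty (e + δ true)) := by
      rcases lt_trichotomy y z with hlt | heq | hgt
      · have hp : p ≤ x := by
          by_contra hc; push Not at hc; nlinarith [mul_pos (sub_pos.2 hc) (sub_pos.2 hlt)]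
        have hd : δ false ≤ δ true := by
          refine Real.log_le_log (div_pos (bern_pos hz0 hz1 _) (bern_pos hy0 hy1 _)) ?_
          simp only [bern_true, bern_false]
          rw [div_le_div_iff₀ (by linarith) hy0]; nlinarith
        have := penalty_mono (add_le_add_right hd e)
        nlinarith
      · subst heq
        have : δ false = δ true := by
          simp only [hδ, bern_true, bern_false, div_self hy0.ne', div_self (sub_pos.2 hy1).ne']
        rw [this]; simp
      · have hp : x ≤ p := by
          by_contra hc; push Not at hc; nlinarith [mul_pos (sub_pos.2 hc) (sub_pos.2 hgt)]
        have hd : δ true ≤ δ false := by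
          refine Real.log_le_log (div_pos (bern_pos hz0 hz1 _) (bern_pos hy0 hy1 _)) ?_
          simp only [bern_true, bern_false]
          rw [div_le_div_iff₀ hy0 (by linarith)]; nlinarith
        have := penalty_mono (add_le_add_right hd e)
        nlinarith
    linarith
  refine hxle.trans ?_
  -- Whatever the current value `e`, the exponential term of the penalty does not grow in mean; only
  -- its linear term drifts, by at most `kl x z`.
  have hexp : mean x (fun c => Real.exp (δ c)) ≤ 1 := by
    have := mean_div_le_one (p := x) (s := z) hy0 hy1 hxy
    refine le_trans (le_of_eq ?_) this
    congr 1
    funext c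
    exact Real.exp_log (div_pos (bern_pos hz0 hz1 _) (bern_pos hy0 hy1 _))
  have hneg : - mean x δ ≤ kl x z := by
    have e1 : kl x z + mean x δ = kl x y := by
      have a1 : (1 - x) ≠ 0 := by linarith
      have a2 : (1 - y) ≠ 0 := by linarith
      have a3 : (1 - z) ≠ 0 := by linarith
      simp only [kl, mean, hδ, bern_true, bern_false]
      rw [Real.log_div hx0.ne' hz0.ne', Real.log_div a1 a3, Real.log_div hz0.ne' hy0.ne',
        Real.log_div a3 a2, Real.log_div hx0.ne' hy0.ne', Real.log_div a1 a2]
      ring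
    have := kl_nonneg hx0.le hx1.le hy0 hy1
    linarith
  by_cases he : 0 ≤ e
  · have h1 : mean x (fun c => penalty (e + δ c)) ≤
        mean x (fun c => Real.exp e * Real.exp (δ c) - 1 - e - δ c) := by
      apply mean_mono hx0.le hx1.le
      intro c
      have := penalty_le (e + δ c)
      rw [Real.exp_add] at this
      linarith
    have h2 : mean x (fun c => Real.exp e * Real.exp (δ c) - 1 - e - δ c)
        = Real.exp e * mean x (fun c => Real.exp (δ c)) - 1 - e - mean x δ := by
      unfold mean; ring
    have h3 : penalty e = Real.exp e - 1 - e := by simp [penalty, he]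
    have := mul_le_mul_of_nonneg_left hexp (Real.exp_pos e).le
    linarith
  · push Not at he
    have h1 : mean x (fun c => penalty (e + δ c)) ≤
        mean x (fun c => Real.exp (δ c) - 1 - δ c) := by
      apply mean_mono hx0.le hx1.le
      intro c
      exact (penalty_mono (by linarith : e + δ c ≤ δ c)).trans (penalty_le _)
    have h2 : mean x (fun c => Real.exp (δ c) - 1 - δ c)
        = mean x (fun c => Real.exp (δ c)) - 1 - mean x δ := by
      unfold mean; ring
    have := penalty_nonneg e
    linarith

/-- The likelihood-ratio test of `y` against `z` when the true head probability is beyond `z`. -/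
lemma mean_exp_half_le {p y z : ℝ} (hy0 : 0 < y) (hy1 : y < 1)
    (hz0 : 0 < z) (hz1 : z < 1) (h : 0 ≤ (p - z) * (z - y)) :
    mean p (fun c => Real.exp (1 / 2 * Real.log (bern y c / bern z c))) ≤
      √(y * z) + √((1 - y) * (1 - z)) := by
  have hE : ∀ c, Real.exp (1 / 2 * Real.log (bern y c / bern z c)) = √(bern y c / bern z c) := by
    intro c
    rw [Real.sqrt_eq_rpow, Real.rpow_def_of_pos (div_pos (bern_pos hy0 hy1 _) (bern_pos hz0 hz1 _)),
      mul_comm]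
  simp only [hE]
  have h1 : z * √(y / z) = √(y * z) := by
    have : y * z = z ^ 2 * (y / z) := by field_simp
    rw [this, Real.sqrt_mul (by positivity), Real.sqrt_sq hz0.le]
  have hz1' : (0:ℝ) < 1 - z := by linarith
  have hy1' : (0:ℝ) < 1 - y := by linarith
  have h2 : (1 - z) * √((1 - y) / (1 - z)) = √((1 - y) * (1 - z)) := by
    have : (1 - y) * (1 - z) = (1 - z) ^ 2 * ((1 - y) / (1 - z)) := by field_simp
    rw [this, Real.sqrt_mul (by positivity), Real.sqrt_sq hz1'.le]
  have h3 : 0 ≤ (p - z) * (√((1 - y) / (1 - z)) - √(y / z)) := by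
    rcases lt_trichotomy z y with hlt | heq | hgt
    · have hp : p ≤ z := by
        by_contra hc; push Not at hc; nlinarith [mul_pos (sub_pos.2 hc) (sub_pos.2 hlt)]
      have : √((1 - y) / (1 - z)) ≤ √(y / z) := by
        apply Real.sqrt_le_sqrt
        rw [div_le_div_iff₀ hz1' hz0]; nlinarith
      nlinarith
    · subst heq; simp [div_self hz0.ne', div_self hz1'.ne']
    · have hp : z ≤ p := by
        by_contra hc; push Not at hc; nlinarith [mul_pos (sub_pos.2 hc) (sub_pos.2 hgt)]
      have : √(y / z) ≤ √((1 - y) / (1 - z)) := by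
        apply Real.sqrt_le_sqrt
        rw [div_le_div_iff₀ hz0 hz1']; nlinarith
      nlinarith
  simp only [mean, bern_true, bern_false]
  nlinarith

/-! ### Supermartingale bounds along the random history -/

lemma tsum_map_mul {X Y : Type*} (p : PMF X) (f : X → Y) (g : Y → ℝ≥0∞) :
    ∑' y, (p.map f) y * g y = ∑' x, p x * g (f x) := by
  classical
  simp only [PMF.map_apply, ← ENNReal.tsum_mul_right]
  rw [ENNReal.tsum_comm]
  refine tsum_congr fun x => ?_
  rw [tsum_eq_single (f x)]
  · simp
  · intro y hy; simp [hy]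

lemma tsum_bind_mul {X Y : Type*} (p : PMF X) (f : X → PMF Y) (g : Y → ℝ≥0∞) :
    ∑' y, (p.bind f) y * g y = ∑' x, p x * ∑' y, f x y * g y := by
  simp only [PMF.bind_apply, ← ENNReal.tsum_mul_right, ← ENNReal.tsum_mul_left]
  rw [ENNReal.tsum_comm]
  simp only [mul_assoc]

lemma coinFlip_true (x : unitInterval) : coinFlip x true = ENNReal.ofReal x := by
  simp only [coinFlip, PMF.ofFintype_apply, cond_true]
  rw [ENNReal.ofReal]
  congr 1
  exact (Real.toNNReal_of_nonneg x.2.1).symm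

lemma coinFlip_false (x : unitInterval) : coinFlip x false = ENNReal.ofReal (1 - x) := by
  simp only [coinFlip, PMF.ofFintype_apply, cond_false]
  rw [ENNReal.ofReal]
  congr 1
  exact (Real.toNNReal_of_nonneg (unitInterval.symm x).2.1).symm

lemma tsum_coinFlip_mul (x : unitInterval) (G : Bool → ℝ) (hG : ∀ c, 0 ≤ G c) :
    ∑' c, coinFlip x c * ENNReal.ofReal (G c) = ENNReal.ofReal (mean x G) := by
  rw [tsum_fintype, Fintype.sum_bool, coinFlip_true, coinFlip_false,
    ← ENNReal.ofReal_mul x.2.1, ← ENNReal.ofReal_mul (by have := x.2.2; linarith),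
    ← ENNReal.ofReal_add]
  · rfl
  · exact mul_nonneg x.2.1 (hG _)
  · exact mul_nonneg (by have := x.2.2; linarith) (hG _)

variable {B : ℕ}

lemma history_length (A : Algorithm B) (adv : Adversary B) (t : ℕ) (h : List Bool)
    (hh : A.history adv t h ≠ 0) : h.length = t := by
  induction t generalizing h with
  | zero =>
    rw [Algorithm.history, PMF.pure_apply] at hh
    simp at hh
    simp [hh]
  | succ t ih =>
    rw [Algorithm.history, ← PMF.mem_support_iff, PMF.mem_support_bind_iff] at hh
    obtain ⟨h', hh', hm⟩ := hh
    rw [PMF.mem_support_map_iff] at hm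
    obtain ⟨b, -, rfl⟩ := hm
    simp [ih h' hh']

/-- A nonnegative functional of the history whose conditional mean grows by at most `d` per flip. -/
lemma tsum_history_mul_le (A : Algorithm B) (adv : Adversary B) (n : ℕ) (G : List Bool → ℝ) (d : ℝ)
    (hd : 0 ≤ d) (hG : ∀ h, 0 ≤ G h)
    (hstep : ∀ h, h.length < n → mean (adv h (A.query h)) (fun c => G (c :: h)) ≤ G h + d) :
    ∀ t ≤ n, ∑' h, A.history adv t h * ENNReal.ofReal (G h) ≤ ENNReal.ofReal (G [] + t * d) := by
  intro t
  induction t with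
  | zero =>
    intro _
    rw [Algorithm.history, tsum_eq_single []]
    · simp
    · intro h hh; simp [PMF.pure_apply, hh]
  | succ t ih =>
    intro ht
    rw [Algorithm.history, tsum_bind_mul]
    have key : ∀ h, A.history adv t h * ∑' y, (PMF.map (fun b => b :: h)
        (coinFlip (adv h (A.query h)))) y * ENNReal.ofReal (G y)
        ≤ A.history adv t h * ENNReal.ofReal (G h) + A.history adv t h * ENNReal.ofReal d := by
      intro h
      by_cases h0 : A.history adv t h = 0
      · simp [h0]
      rw [tsum_map_mul, tsum_coinFlip_mul _ (fun c => G (c :: h)) (fun c => hG _), ← mul_add,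
        ← ENNReal.ofReal_add (hG _) hd]
      gcongr
      exact hstep h (by rw [history_length A adv t h h0]; omega)
    refine (ENNReal.tsum_le_tsum key).trans ?_
    rw [ENNReal.tsum_add, ENNReal.tsum_mul_right, PMF.tsum_coe, one_mul]
    refine (add_le_add_left (ih (by omega)) _).trans ?_
    rw [← ENNReal.ofReal_add (by have := hG []; positivity) hd]
    apply ENNReal.ofReal_le_ofReal
    push_cast
    linarith

/-- Markov's inequality along the history. -/
lemma prob_history_ge_le (A : Algorithm B) (adv : Adversary B) (n : ℕ) (G : List Bool → ℝ) (d x : ℝ)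
    (hd : 0 ≤ d) (hx : 0 < x) (hG : ∀ h, 0 ≤ G h)
    (hstep : ∀ h, h.length < n → mean (adv h (A.query h)) (fun c => G (c :: h)) ≤ G h + d) :
    (A.history adv n).toOuterMeasure {h | x ≤ G h} ≤ ENNReal.ofReal ((G [] + n * d) / x) := by
  have h1 := tsum_history_mul_le A adv n G d hd hG hstep n le_rfl
  rw [ENNReal.ofReal_div_of_pos hx, PMF.toOuterMeasure_apply]
  rw [ENNReal.le_div_iff_mul_le (Or.inl (by simpa using hx)) (Or.inl ENNReal.ofReal_ne_top),
    ← ENNReal.tsum_mul_right]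
  refine (ENNReal.tsum_le_tsum fun h => ?_).trans h1
  by_cases hh : x ≤ G h
  · simp only [Set.indicator, Set.mem_ofPred_eq, hh, if_true]
    gcongr
  · simp [Set.indicator, hh]

/-- The sum of the increments `f` along a history. -/
def cum (f : List Bool → Bool → ℝ) : List Bool → ℝ
  | [] => 0
  | c :: h => cum f h + f h c

@[simp] lemma cum_nil (f : List Bool → Bool → ℝ) : cum f [] = 0 := rfl
@[simp] lemma cum_cons (f : List Bool → Bool → ℝ) (c : Bool) (h : List Bool) :
    cum f (c :: h) = cum f h + f h c := rfl

/-- Chernoff's bound along the history. -/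
lemma prob_cum_ge_le (A : Algorithm B) (adv : Adversary B) (n : ℕ) (f : List Bool → Bool → ℝ) (x : ℝ)
    (hstep : ∀ h, h.length < n → mean (adv h (A.query h)) (fun c => Real.exp (f h c)) ≤ 1) :
    (A.history adv n).toOuterMeasure {h | x ≤ cum f h} ≤ ENNReal.ofReal (Real.exp (-x)) := by
  have := prob_history_ge_le A adv n (fun h => Real.exp (cum f h)) 0 (Real.exp x) le_rfl
    (Real.exp_pos x) (fun _ => (Real.exp_pos _).le) (fun h hh => by
      have h1 := mul_le_mul_of_nonneg_left (hstep h hh) (Real.exp_pos (cum f h)).le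
      simp only [cum_cons, Real.exp_add, add_zero]
      unfold mean at h1 ⊢
      linarith)
  simpa [Real.exp_neg] using this

/-- It suffices to bound the probability of a bad event on the histories of full length. -/
lemma solves_of_prob_le (A : Algorithm B) {τ α c β : ℝ} (hβ : 0 ≤ β)
    (H : ∀ p : Fin (B + 1) → ℝ, IsInstance p → ∀ adv : Adversary B, adv.IsBounded p (c * α) →
      ∃ S : Set (List Bool), (A.history adv A.flips).toOuterMeasure S ≤ ENNReal.ofReal β ∧
        ∀ h, h.length = A.flips → h ∉ S → IsGood p τ (α * (1 + c)) (A.output h)) :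
    A.Solves τ α c β := by
  intro p hp adv hadv
  obtain ⟨S, hS, hgood⟩ := H p hp adv hadv
  rw [Algorithm.outputLaw, PMF.toOuterMeasure_map_apply]
  set μ := A.history adv A.flips
  set W := A.output ⁻¹' {i | IsGood p τ (α * (1 + c)) i}
  have h1 : (1 : ℝ≥0∞) ≤ μ.toOuterMeasure S + μ.toOuterMeasure W := by
    rw [PMF.toOuterMeasure_apply, PMF.toOuterMeasure_apply, ← ENNReal.tsum_add, ← μ.tsum_coe]
    refine ENNReal.tsum_le_tsum fun h => ?_
    by_cases h0 : μ h = 0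
    · simp [h0]
    by_cases hs : h ∈ S
    · simp [Set.indicator, hs]
    · have : h ∈ W := hgood h (history_length A adv _ h h0) hs
      simp [Set.indicator, this]
  rw [ENNReal.ofReal_sub 1 hβ, ENNReal.ofReal_one, tsub_le_iff_left]
  exact h1.trans (by gcongr)

/-! ### The Bayesian learner -/

/-- The parameters of the search: the channel `a < s < b`, a `rate` below its capacity, the
thresholds `dev` and `thr` of the statistics, the number `B` of indices, the number `T` of flips
of the learner and the number `N` of flips of each of the two final tests. -/
structure Config where
  a : ℝ
  b : ℝ
  s : ℝ
  rate : ℝ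
  dev : ℝ
  thr : ℝ
  B : ℕ
  T : ℕ
  N : ℕ

namespace Config

/-- The order relations between the parameters. -/
structure Valid (P : Config) : Prop where
  a_pos : 0 < P.a
  a_lt : P.a < P.s
  lt_b : P.s < P.b
  b_lt : P.b < 1
  rate_nonneg : 0 ≤ P.rate
  B_pos : 0 < P.B

variable (P : Config)

/-- The capacity-achieving input law puts mass `q` on the input `b`. -/
def q : ℝ := (P.s - P.a) / (P.b - P.a)

/-- The index containing the `q`-quantile of the weights `w`. -/
def quantile (w : ℕ → ℝ) : ℕ := sInf {i | P.q < ∑ x ∈ Finset.range (i + 1), w x}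

/-- The relative position of the `q`-quantile inside its index. -/
def frac (w : ℕ → ℝ) : ℝ :=
  (P.q - ∑ x ∈ Finset.range (P.quantile w), w x) / w (P.quantile w)

/-- The head probability predicted by the index `k`; the index of the quantile is split. -/
def predict (w : ℕ → ℝ) (k : ℕ) : ℝ :=
  if k < P.quantile w then P.b else if P.quantile w < k then P.a
  else P.frac w * P.b + (1 - P.frac w) * P.a

/-- The weights after a history: each of the first `T` flips multiplies them by the likelihood
ratio of the prediction and of the law `s`. -/
def weight : List Bool → ℕ → ℝ
  | [] => fun _ => 1 / P.B
  | c :: h => if h.length < P.T then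
      fun k => weight h k * (bern (P.predict (weight h) k) c / bern P.s c) else weight h

/-- The index of the quantile after the history `h`. -/
def atom (h : List Bool) : ℕ := P.quantile (P.weight h)

/-- The head probability predicted by the index `k` after the history `h`. -/
def level (h : List Bool) (k : ℕ) : ℝ := P.predict (P.weight h) k

/-- The coin flipped by the learner: one of the two coins bounding the index of the quantile. -/
def coin (h : List Bool) : ℕ :=
  if P.q ≤ P.frac (P.weight h) then P.atom h + 1 else P.atom h

/-- The log-likelihood gained by the index `k`. -/
def gain (k : ℕ) (h : List Bool) (c : Bool) : ℝ :=
  if h.length < P.T then Real.log (bern (P.level h k) c / bern P.s c) else 0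

/-- Gain of `k` on the coins above `k`, compared with `rate`. -/
def rightGain (k : ℕ) (h : List Bool) (c : Bool) : ℝ :=
  if h.length < P.T ∧ k < P.coin h then Real.log (bern (P.level h k) c / bern P.s c)
    - (if P.atom h = k then 0 else P.rate) else 0

/-- Gain of the prediction `b` on the coins above `k`, compared with `rate`. -/
def rightFull (k : ℕ) (h : List Bool) (c : Bool) : ℝ :=
  if h.length < P.T ∧ k < P.coin h then Real.log (bern P.b c / bern P.s c) - P.rate else 0

/-- Gain of `k` on the coins up to `k`, compared with `rate`. -/
def leftGain (k : ℕ) (h : List Bool) (c : Bool) : ℝ :=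
  if h.length < P.T ∧ P.coin h ≤ k then Real.log (bern (P.level h k) c / bern P.s c)
    - (if P.atom h = k then 0 else P.rate) else 0

/-- Gain of the prediction `a` on the coins up to `k`, compared with `rate`. -/
def leftFull (k : ℕ) (h : List Bool) (c : Bool) : ℝ :=
  if h.length < P.T ∧ P.coin h ≤ k then Real.log (bern P.a c / bern P.s c) - P.rate else 0

/-- The gain that the index `k` misses on the coin `k` by being split. -/
def lowDefect (k : ℕ) (h : List Bool) (c : Bool) : ℝ :=
  if h.length < P.T ∧ P.atom h = k ∧ P.coin h = k then
    Real.log (bern P.a c / bern (P.level h k) c) else 0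

/-- The gain that the index `k` misses on the coin `k + 1` by being split. -/
def highDefect (k : ℕ) (h : List Bool) (c : Bool) : ℝ :=
  if h.length < P.T ∧ P.atom h = k ∧ P.coin h = k + 1 then
    Real.log (bern P.b c / bern (P.level h k) c) else 0

/-- Gain of the prediction `x` on the coins `k + 1, …, k'`. -/
def midGain (x : ℝ) (k k' : ℕ) (h : List Bool) (c : Bool) : ℝ :=
  if h.length < P.T ∧ k < P.coin h ∧ P.coin h ≤ k' then
    Real.log (bern x c / bern P.s c) else 0

/-- The flips so far are consistent with all coins above `k` being high. -/
def RightOK (h : List Bool) (k : ℕ) : Prop :=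
  -P.dev ≤ cum (P.rightGain k) h ∧ -P.dev ≤ cum (P.rightFull k) h

/-- The flips so far are consistent with all coins up to `k` being low. -/
def LeftOK (h : List Bool) (k : ℕ) : Prop :=
  -P.dev ≤ cum (P.leftGain k) h ∧ -P.dev ≤ cum (P.leftFull k) h

variable {P}

lemma weight_cons (c : Bool) (h : List Bool) : P.weight (c :: h) = if h.length < P.T then
    fun k => P.weight h k * (bern (P.level h k) c / bern P.s c) else P.weight h := rfl

lemma coin_cases (h : List Bool) : P.coin h = P.atom h ∨ P.coin h = P.atom h + 1 := by
  unfold coin; split_ifs <;> simp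

lemma level_of_lt {h : List Bool} {k : ℕ} (hk : k < P.atom h) : P.level h k = P.b := by
  unfold level predict; exact if_pos hk

lemma level_of_gt {h : List Bool} {k : ℕ} (hk : P.atom h < k) : P.level h k = P.a := by
  unfold level predict
  exact (if_neg (not_lt.2 hk.le)).trans (if_pos hk)

lemma Valid.a_lt_b (hP : P.Valid) : P.a < P.b := hP.a_lt.trans hP.lt_b
lemma Valid.s_pos (hP : P.Valid) : 0 < P.s := hP.a_pos.trans hP.a_lt
lemma Valid.s_lt (hP : P.Valid) : P.s < 1 := hP.lt_b.trans hP.b_lt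
lemma Valid.b_pos (hP : P.Valid) : 0 < P.b := hP.s_pos.trans hP.lt_b
lemma Valid.a_lt_one (hP : P.Valid) : P.a < 1 := hP.a_lt.trans hP.s_lt

lemma Valid.q_pos (hP : P.Valid) : 0 < P.q :=
  div_pos (sub_pos.2 hP.a_lt) (sub_pos.2 hP.a_lt_b)

lemma Valid.q_lt (hP : P.Valid) : P.q < 1 := by
  unfold q; rw [div_lt_one (sub_pos.2 hP.a_lt_b)]; linarith [hP.lt_b]

lemma Valid.s_eq (hP : P.Valid) : P.s = P.q * P.b + (1 - P.q) * P.a := by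
  have : P.b - P.a ≠ 0 := (sub_pos.2 hP.a_lt_b).ne'
  unfold q; field_simp; ring

/-! ### Weights, predictions and the flipped coin -/

/-- A positive weight function on `{0, …, B - 1}` of total mass one. -/
structure IsWeight (B : ℕ) (w : ℕ → ℝ) : Prop where
  pos : ∀ k < B, 0 < w k
  sum : ∑ k ∈ Finset.range B, w k = 1

section
variable {w : ℕ → ℝ}

lemma quantile_spec (hP : P.Valid) (hw : IsWeight P.B w) :
    P.quantile w < P.B ∧ ∑ x ∈ Finset.range (P.quantile w), w x ≤ P.q ∧
      P.q < ∑ x ∈ Finset.range (P.quantile w + 1), w x := by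
  have hB := hP.B_pos
  have hmem : P.B - 1 ∈ {i | P.q < ∑ x ∈ Finset.range (i + 1), w x} := by
    show P.q < _
    rw [Nat.sub_add_cancel hB, hw.sum]; exact hP.q_lt
  have h1 : P.quantile w ∈ {i | P.q < ∑ x ∈ Finset.range (i + 1), w x} := Nat.sInf_mem ⟨_, hmem⟩
  have h2 : P.quantile w ≤ P.B - 1 := Nat.sInf_le hmem
  refine ⟨by omega, ?_, h1⟩
  by_contra hc
  push Not at hc
  rcases Nat.eq_zero_or_pos (P.quantile w) with h0 | h0
  · rw [h0] at hc; simp at hc; linarith [hP.q_pos]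
  · have : P.quantile w ≤ P.quantile w - 1 := Nat.sInf_le (by
      show P.q < _
      rwa [Nat.sub_add_cancel h0])
    omega

lemma frac_spec (hP : P.Valid) (hw : IsWeight P.B w) : 0 ≤ P.frac w ∧ P.frac w ≤ 1 := by
  obtain ⟨h1, h2, h3⟩ := quantile_spec hP hw
  have hpos := hw.pos _ h1
  rw [Finset.sum_range_succ] at h3
  unfold frac
  exact ⟨div_nonneg (by linarith) hpos.le, by rw [div_le_one hpos]; linarith⟩

/-- Guarantees that the nonexistent coin `0` is never flipped. With no mass below index `0`, its
fraction is `q` divided by a weight that is at most one. -/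
lemma frac_ge_of_quantile_eq_zero (hP : P.Valid) (hw : IsWeight P.B w) (h0 : P.quantile w = 0) :
    P.q ≤ P.frac w := by
  obtain ⟨h1, -, -⟩ := quantile_spec hP hw
  have hpos := hw.pos _ h1
  have hle : w (P.quantile w) ≤ 1 := by
    rw [← hw.sum]
    exact Finset.single_le_sum (f := w) (fun i hi => (hw.pos i (Finset.mem_range.1 hi)).le)
      (Finset.mem_range.2 h1)
  unfold frac
  rw [h0] at hpos hle ⊢
  simp only [Finset.range_zero, Finset.sum_empty, sub_zero]
  rw [le_div_iff₀ hpos]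
  nlinarith [hP.q_pos]

lemma predict_mem (hP : P.Valid) (hw : IsWeight P.B w) (k : ℕ) :
    P.a ≤ P.predict w k ∧ P.predict w k ≤ P.b := by
  obtain ⟨h0, h1⟩ := frac_spec hP hw
  have := hP.a_lt_b
  unfold predict
  split_ifs
  · exact ⟨this.le, le_rfl⟩
  · exact ⟨le_rfl, this.le⟩
  · constructor <;> nlinarith

/-- The mean prediction is exactly `s`. -/
lemma sum_predict (hP : P.Valid) (hw : IsWeight P.B w) :
    ∑ k ∈ Finset.range P.B, w k * P.predict w k = P.s := by
  obtain ⟨h1, h2, h3⟩ := quantile_spec hP hw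
  have hpos := hw.pos _ h1
  set i := P.quantile w with hi
  have hsplit : ∀ f : ℕ → ℝ, ∑ k ∈ Finset.range P.B, f k = ∑ k ∈ Finset.range i, f k + f i
      + ∑ k ∈ Finset.Ico (i + 1) P.B, f k := by
    intro f
    rw [← Finset.sum_range_succ, Finset.sum_range_add_sum_Ico _ (by omega)]
  have hs := hsplit w
  rw [hw.sum] at hs
  rw [hsplit]
  have e1 : ∑ k ∈ Finset.range i, w k * P.predict w k = (∑ k ∈ Finset.range i, w k) * P.b := by
    rw [Finset.sum_mul]
    refine Finset.sum_congr rfl fun k hk => ?_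
    unfold predict; rw [if_pos (by rw [← hi]; exact Finset.mem_range.1 hk)]
  have e2 : ∑ k ∈ Finset.Ico (i + 1) P.B, w k * P.predict w k
      = (∑ k ∈ Finset.Ico (i + 1) P.B, w k) * P.a := by
    rw [Finset.sum_mul]
    refine Finset.sum_congr rfl fun k hk => ?_
    have := (Finset.mem_Ico.1 hk).1
    unfold predict
    rw [if_neg (by rw [← hi]; omega), if_pos (by rw [← hi]; omega)]
  have e3 : w i * P.predict w i = (P.q - ∑ k ∈ Finset.range i, w k) * P.b
      + (w i - (P.q - ∑ k ∈ Finset.range i, w k)) * P.a := by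
    have hf : w i * P.frac w = P.q - ∑ k ∈ Finset.range i, w k := by
      unfold frac; rw [← hi]; field_simp
    unfold predict
    rw [if_neg (by rw [← hi]; omega), if_neg (by rw [← hi]; omega), ← hf]; ring
  rw [e1, e2, e3]
  have := hP.s_eq
  have e4 : ∑ k ∈ Finset.Ico (i + 1) P.B, w k = 1 - ∑ k ∈ Finset.range i, w k - w i := by linarith
  rw [e4]
  linear_combination -this
end

lemma isWeight_weight (hP : P.Valid) (h : List Bool) : IsWeight P.B (P.weight h) := by
  induction h with
  | nil =>
    have hB : (0:ℝ) < P.B := by exact_mod_cast hP.B_pos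
    refine ⟨fun k _ => by simp only [weight]; positivity, ?_⟩
    simp [weight, hB.ne']
  | cons c h ih =>
    unfold weight
    split_ifs with hT
    · have hs := bern_pos hP.s_pos hP.s_lt c
      refine ⟨fun k hk => ?_, ?_⟩
      · have hm := predict_mem hP ih k
        exact mul_pos (ih.pos k hk) (div_pos (bern_pos (hP.a_pos.trans_le hm.1)
          (hm.2.trans_lt hP.b_lt) c) hs)
      · have h1 := sum_predict hP ih
        have h2 := ih.sum
        -- Since the mean prediction is `s`, the predictive probability of either outcome is that of
        -- `s`, which preserves the total mass.
        have e : ∑ k ∈ Finset.range P.B, P.weight h k * bern (P.predict (P.weight h) k) c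
            = bern P.s c := by
          cases c
          · simp only [bern_false, mul_sub, mul_one, Finset.sum_sub_distrib]
            rw [h1, h2]
          · simpa using h1
        simp only [← mul_div_assoc]
        rw [← Finset.sum_div, e, div_self hs.ne']
    · exact ih

lemma atom_lt (hP : P.Valid) (h : List Bool) : P.atom h < P.B :=
  (quantile_spec hP (isWeight_weight hP h)).1

lemma coin_pos (hP : P.Valid) (h : List Bool) : 1 ≤ P.coin h := by
  unfold coin
  split_ifs with hq
  · omega
  · by_contra h0
    exact hq (frac_ge_of_quantile_eq_zero hP (isWeight_weight hP h)
      (show P.atom h = 0 by omega))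

lemma coin_le (hP : P.Valid) (h : List Bool) : P.coin h ≤ P.B := by
  have := atom_lt hP h
  rcases coin_cases (P := P) h with e | e <;> omega

lemma level_mem (hP : P.Valid) (h : List Bool) (k : ℕ) :
    P.a ≤ P.level h k ∧ P.level h k ≤ P.b := predict_mem hP (isWeight_weight hP h) k

lemma level_pos (hP : P.Valid) (h : List Bool) (k : ℕ) : 0 < P.level h k :=
  hP.a_pos.trans_le (level_mem hP h k).1

lemma level_lt (hP : P.Valid) (h : List Bool) (k : ℕ) : P.level h k < 1 :=
  (level_mem hP h k).2.trans_lt hP.b_lt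

lemma level_atom (h : List Bool) : P.level h (P.atom h) =
    P.frac (P.weight h) * P.b + (1 - P.frac (P.weight h)) * P.a := by
  unfold level predict atom; simp

/-- The split index predicts at least `s` when its upper coin is flipped. -/
lemma le_level_of_lt_coin (hP : P.Valid) {h : List Bool} {k : ℕ} (hk : k < P.coin h) :
    P.s ≤ P.level h k := by
  rcases lt_trichotomy k (P.atom h) with h1 | h1 | h1
  · rw [level_of_lt h1]; exact hP.lt_b.le
  · subst h1
    have hq : P.q ≤ P.frac (P.weight h) := by
      by_contra hq
      unfold coin at hk; rw [if_neg hq] at hk; omega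
    rw [level_atom, hP.s_eq]
    nlinarith [hP.a_lt_b]
  · rcases coin_cases (P := P) h with e | e <;> omega

/-- The split index predicts at most `s` when its lower coin is flipped. -/
lemma level_le_of_coin_le (hP : P.Valid) {h : List Bool} {k : ℕ} (hk : P.coin h ≤ k) :
    P.level h k ≤ P.s := by
  rcases lt_trichotomy k (P.atom h) with h1 | h1 | h1
  · rcases coin_cases (P := P) h with e | e <;> omega
  · subst h1
    have hq : ¬ P.q ≤ P.frac (P.weight h) := by
      intro hq
      unfold coin at hk; rw [if_pos hq] at hk; omega
    rw [level_atom]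
    have := hP.s_eq
    push Not at hq
    nlinarith [hP.a_lt_b]
  · rw [level_of_gt h1]; exact hP.a_lt.le

/-! ### Accounting for the log-likelihood gains -/

lemma cum_gain (hP : P.Valid) (h : List Bool) {k : ℕ} (hk : k < P.B) :
    cum (P.gain k) h = Real.log (P.weight h k) + Real.log P.B := by
  induction h with
  | nil => simp [weight]
  | cons c h ih =>
    rw [cum_cons, ih, weight_cons]
    unfold gain
    split_ifs with hT
    · have hs := bern_pos hP.s_pos hP.s_lt c
      have hl := bern_pos (level_pos hP h k) (level_lt hP h k) c
      rw [Real.log_mul ((isWeight_weight hP h).pos k hk).ne' (div_pos hl hs).ne']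
      ring
    · ring

/-- The gain is the logarithm of the weight relative to its initial value `1 / B`, and a weight
never exceeds the total mass one. -/
lemma cum_gain_le (hP : P.Valid) (h : List Bool) {k : ℕ} (hk : k < P.B) :
    cum (P.gain k) h ≤ Real.log P.B := by
  rw [cum_gain hP h hk]
  have hw := isWeight_weight hP h
  have : P.weight h k ≤ 1 := by
    rw [← hw.sum]
    exact Finset.single_le_sum (f := P.weight h)
      (fun i hi => (hw.pos i (Finset.mem_range.1 hi)).le) (Finset.mem_range.2 hk)
  have := Real.log_nonpos (hw.pos k hk).le this
  linarith

lemma log_div_sub_log_div {x y z : ℝ} (hx : 0 < x) (hy : 0 < y) (hz : 0 < z) :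
    Real.log (x / z) - Real.log (x / y) = Real.log (y / z) := by
  rw [Real.log_div hx.ne' hz.ne', Real.log_div hx.ne' hy.ne', Real.log_div hy.ne' hz.ne']; ring

/-- The gain of `k`, seen from an index `k'` above it. -/
lemma cum_gain_ge (hP : P.Valid) {k k' : ℕ} (hkk : k < k') (h : List Bool) :
    cum (P.rightGain k) h + cum (P.leftFull k') h - cum (P.lowDefect k) h
      - cum (P.midGain P.a k k') h + P.rate * min h.length P.T ≤ cum (P.gain k) h := by
  -- Flip by flip: a coin up to `k` is credited through `leftFull k'`, corrected by `lowDefect k` if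
  -- `k` is split; a coin above `k'` is credited through `rightGain k`. A coin in between is
  -- credited twice, and `midGain` removes one credit; the rate left over there has the right sign.
  induction h with
  | nil => simp
  | cons c h ih =>
    simp only [cum_cons, List.length_cons]
    have hr := hP.rate_nonneg
    by_cases hT : h.length < P.T
    · have hm : (min (h.length + 1) P.T : ℕ) = min h.length P.T + 1 := by omega
      rw [hm, Nat.cast_add, Nat.cast_one]
      suffices P.rightGain k h c + P.leftFull k' h c - P.lowDefect k h c - P.midGain P.a k k' h c
          + P.rate ≤ P.gain k h c by linarith
      have hs := bern_pos hP.s_pos hP.s_lt c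
      have ha := bern_pos hP.a_pos hP.a_lt_one c
      have hl := bern_pos (level_pos hP h k) (level_lt hP h k) c
      have hc := coin_cases (P := P) h
      unfold rightGain leftFull lowDefect midGain gain
      rcases le_or_gt (P.coin h) k with h1 | h1
      · have n1 : ¬ k < P.coin h := by omega
        have n2 : P.coin h ≤ k' := by omega
        simp only [hT, n1, n2, true_and, false_and, and_false, if_false, if_true]
        by_cases h2 : P.atom h = k
        · have h3 : P.coin h = k := by omega
          simp only [h2, h3, and_self, if_true]
          have := log_div_sub_log_div ha hl hs
          linarith
        · have h3 : P.atom h < k := by omega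
          rw [level_of_gt h3]
          simp [h2]
      · have n1 : ¬ (P.coin h = k) := by omega
        simp only [hT, h1, n1, true_and, and_false, if_false, if_true]
        rcases le_or_gt (P.coin h) k' with h2 | h2
        · simp only [h2, if_true]
          split_ifs <;> linarith
        · have n2 : ¬ (P.coin h ≤ k') := by omega
          have n3 : ¬ (P.atom h = k) := by omega
          simp only [n2, n3, if_false]
          linarith
    · have hm : (min (h.length + 1) P.T : ℕ) = min h.length P.T := by omega
      rw [hm]
      simpa [rightGain, leftFull, lowDefect, midGain, gain, hT] using ih

/-- The gain of `k'`, seen from an index `k` below it. -/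
lemma cum_gain_ge' (hP : P.Valid) {k k' : ℕ} (hkk : k < k') (h : List Bool) :
    cum (P.leftGain k') h + cum (P.rightFull k) h - cum (P.highDefect k') h
      - cum (P.midGain P.b k k') h + P.rate * min h.length P.T ≤ cum (P.gain k') h := by
  induction h with
  | nil => simp
  | cons c h ih =>
    simp only [cum_cons, List.length_cons]
    have hr := hP.rate_nonneg
    by_cases hT : h.length < P.T
    · have hm : (min (h.length + 1) P.T : ℕ) = min h.length P.T + 1 := by omega
      rw [hm, Nat.cast_add, Nat.cast_one]
      suffices P.leftGain k' h c + P.rightFull k h c - P.highDefect k' h c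
          - P.midGain P.b k k' h c + P.rate ≤ P.gain k' h c by linarith
      have hs := bern_pos hP.s_pos hP.s_lt c
      have hb := bern_pos hP.b_pos hP.b_lt c
      have hl := bern_pos (level_pos hP h k') (level_lt hP h k') c
      have hc := coin_cases (P := P) h
      unfold leftGain rightFull highDefect midGain gain
      rcases le_or_gt (P.coin h) k' with h1 | h1
      · have n1 : ¬ (P.coin h = k' + 1) := by omega
        simp only [hT, h1, n1, true_and, and_true, and_false, if_false, if_true]
        rcases le_or_gt (P.coin h) k with h2 | h2
        · have n2 : ¬ (k < P.coin h) := by omega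
          have n3 : ¬ (P.atom h = k') := by omega
          simp only [n2, n3, if_false]
          linarith
        · simp only [h2, if_true]
          split_ifs <;> linarith
      · have n1 : ¬ P.coin h ≤ k' := by omega
        have n2 : k < P.coin h := by omega
        simp only [hT, n1, n2, true_and, and_false, if_false, if_true]
        by_cases h2 : P.atom h = k'
        · have h3 : P.coin h = k' + 1 := by omega
          simp only [h2, h3, and_self, if_true]
          have := log_div_sub_log_div hb hl hs
          linarith
        · have h3 : k' < P.atom h := by omega
          rw [level_of_lt h3]
          simp [h2]
    · have hm : (min (h.length + 1) P.T : ℕ) = min h.length P.T := by omega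
      rw [hm]
      simpa [leftGain, rightFull, highDefect, midGain, gain, hT] using ih

/-- `s` is the mixture of `b` and `a` with weights proportional to `s - a` and `b - s`, so by
concavity of the logarithm the mixed log-likelihood ratio is nonpositive for each outcome. -/
lemma cum_midGain_le (hP : P.Valid) (k k' : ℕ) (h : List Bool) :
    (P.s - P.a) * cum (P.midGain P.b k k') h + (P.b - P.s) * cum (P.midGain P.a k k') h ≤ 0 := by
  induction h with
  | nil => simp
  | cons c h ih =>
    simp only [cum_cons]
    suffices (P.s - P.a) * P.midGain P.b k k' h c + (P.b - P.s) * P.midGain P.a k k' h c ≤ 0 by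
      linarith
    unfold midGain
    split_ifs
    · have hs := bern_pos hP.s_pos hP.s_lt c
      have h1 := Real.log_le_sub_one_of_pos (div_pos (bern_pos hP.b_pos hP.b_lt c) hs)
      have h2 := Real.log_le_sub_one_of_pos (div_pos (bern_pos hP.a_pos hP.a_lt_one c) hs)
      have h3 := mul_le_mul_of_nonneg_left h1 (sub_pos.2 hP.a_lt).le
      have h4 := mul_le_mul_of_nonneg_left h2 (sub_pos.2 hP.lt_b).le
      have e : (P.s - P.a) * (bern P.b c / bern P.s c - 1)
          + (P.b - P.s) * (bern P.a c / bern P.s c - 1) = 0 := by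
        cases c <;> simp only [bern_true, bern_false] at hs ⊢ <;> field_simp <;> ring
      linarith
    · simp

/-- Two disjoint intervals cannot both be consistent with the flips, unless the search has
been concentrated on one of their facing ends. -/
lemma defect_of_disjoint (hP : P.Valid) {k k' : ℕ} (hkk : k < k') (hk' : k' < P.B) {h : List Bool}
    (hT : P.T ≤ h.length) (hr : P.RightOK h k) (hl : P.LeftOK h k')
    (hlen : Real.log P.B + 2 * P.dev + P.thr < P.rate * P.T) :
    P.thr ≤ cum (P.lowDefect k) h ∨ P.thr ≤ cum (P.highDefect k') h := by
  have hmin : min h.length P.T = P.T := min_eq_right hT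
  have h1 := cum_gain_ge hP hkk h
  have h2 := cum_gain_ge' hP hkk h
  rw [hmin] at h1 h2
  have h3 := cum_gain_le hP h (hkk.trans hk')
  have h4 := cum_gain_le hP h hk'
  have h5 := cum_midGain_le hP k k' h
  have ha := sub_pos.2 hP.a_lt
  have hb := sub_pos.2 hP.lt_b
  -- If the coins in between do not favour `a`, the account of `k` must show a loss; otherwise they
  -- do not favour `b`, and the account of `k'` must.
  by_cases hm : cum (P.midGain P.a k k') h ≤ 0
  · left; linarith [hr.1, hl.2]
  · right
    have : cum (P.midGain P.b k k') h ≤ 0 := by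
      by_contra hc
      push Not at hm hc
      nlinarith [mul_pos ha hc, mul_pos hb hm]
    linarith [hr.2, hl.1]

end Config

namespace Config

/-! ### The search algorithm -/

variable (P : Config)

open Classical in
/-- The indices certified not to lie above the target. -/
def lowSet (h : List Bool) : Finset ℕ :=
  (Finset.range P.B).filter fun i => P.thr ≤ cum (P.lowDefect i) h

open Classical in
/-- The indices certified not to lie below the target. -/
def highSet (h : List Bool) : Finset ℕ :=
  (Finset.range P.B).filter fun i => P.thr ≤ cum (P.highDefect i) h

/-- The largest index of `lowSet`. -/
def top (h : List Bool) : ℕ := (P.lowSet h).sup id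

/-- The smallest index of `highSet`. -/
def bot (h : List Bool) : ℕ := sInf {i | i ∈ P.highSet h}

/-- The log-likelihood ratio collected by the test which starts at time `t`. -/
def score (t : ℕ) (h : List Bool) (c : Bool) : ℝ :=
  if t ≤ h.length ∧ h.length < t + P.N then Real.log (bern P.b c / bern P.a c) else 0

/-- The coin flipped after the history `h`: the learner is followed by tests of the coin above
`top` and of the coin `bot`. -/
def flip (h : List Bool) : ℕ :=
  if h.length < P.T then P.coin h else if h.length < P.T + P.N then P.top h + 1
  else max 1 (P.bot h)

open Classical in
/-- The index returned after the history `h`. -/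
def answer (h : List Bool) : ℕ :=
  if (P.lowSet h).Nonempty ∧ 0 ≤ cum (P.score P.T) h then P.top h
  else if (P.highSet h).Nonempty ∧ cum (P.score (P.T + P.N)) h < 0 then P.bot h
  else sInf {k | ((P.lowSet h).Nonempty → P.top h < k) ∧ P.RightOK h k}

/-- The search algorithm. -/
def algorithm (hB : 0 < P.B) : Algorithm P.B where
  flips := P.T + 2 * P.N
  query h := ⟨min (P.flip h - 1) (P.B - 1), by omega⟩
  output h := ⟨min (P.answer h) (P.B - 1), by omega⟩

variable {P}

lemma mem_lowSet {h : List Bool} {i : ℕ} :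
    i ∈ P.lowSet h ↔ i < P.B ∧ P.thr ≤ cum (P.lowDefect i) h := by
  simp [lowSet]

lemma mem_highSet {h : List Bool} {i : ℕ} :
    i ∈ P.highSet h ↔ i < P.B ∧ P.thr ≤ cum (P.highDefect i) h := by
  simp [highSet]

lemma le_top {h : List Bool} {i : ℕ} (hi : i ∈ P.lowSet h) : i ≤ P.top h :=
  Finset.le_sup (f := id) hi

lemma top_mem {h : List Bool} (hne : (P.lowSet h).Nonempty) : P.top h ∈ P.lowSet h := by
  obtain ⟨i, hi, he⟩ := Finset.exists_mem_eq_sup _ hne id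
  unfold top; rw [he]; exact hi

lemma bot_le {h : List Bool} {i : ℕ} (hi : i ∈ P.highSet h) : P.bot h ≤ i := Nat.sInf_le hi

lemma bot_mem {h : List Bool} (hne : (P.highSet h).Nonempty) : P.bot h ∈ P.highSet h :=
  Nat.sInf_mem (s := {i | i ∈ P.highSet h}) hne

lemma top_lt (hP : P.Valid) (h : List Bool) : P.top h < P.B := by
  by_cases hne : (P.lowSet h).Nonempty
  · exact (mem_lowSet.1 (top_mem hne)).1
  · rw [Finset.not_nonempty_iff_eq_empty] at hne
    simp [top, hne, hP.B_pos]

lemma bot_lt (hP : P.Valid) (h : List Bool) : P.bot h < P.B := by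
  by_cases hne : (P.highSet h).Nonempty
  · exact (mem_highSet.1 (bot_mem hne)).1
  · rw [Finset.not_nonempty_iff_eq_empty] at hne
    simp [bot, hne, hP.B_pos]

lemma flip_mem (hP : P.Valid) (h : List Bool) : 1 ≤ P.flip h ∧ P.flip h ≤ P.B := by
  have := coin_pos hP h
  have := coin_le hP h
  have := top_lt hP h
  have := bot_lt hP h
  unfold flip
  split_ifs
  · omega
  · omega
  · omega

/-- The truncations in `algorithm` are never active, as the flipped coin is always in `{1, …, B}`.
-/
lemma query_val (hP : P.Valid) (h : List Bool) :
    ((P.algorithm hP.B_pos).query h : ℕ) + 1 = P.flip h := by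
  have := flip_mem hP h
  simp only [algorithm]; omega

/-- Certificates are frozen once the learner stops, so each final test flips one fixed coin. -/
lemma lowSet_cons {h : List Bool} (hT : P.T ≤ h.length) (c : Bool) :
    P.lowSet (c :: h) = P.lowSet h := by
  ext i
  rw [mem_lowSet, mem_lowSet, cum_cons]
  simp [lowDefect, not_lt.2 hT]

lemma highSet_cons {h : List Bool} (hT : P.T ≤ h.length) (c : Bool) :
    P.highSet (c :: h) = P.highSet h := by
  ext i
  rw [mem_highSet, mem_highSet, cum_cons]
  simp [highDefect, not_lt.2 hT]

lemma top_cons {h : List Bool} (hT : P.T ≤ h.length) (c : Bool) : P.top (c :: h) = P.top h := by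
  unfold top; rw [lowSet_cons hT]

lemma bot_cons {h : List Bool} (hT : P.T ≤ h.length) (c : Bool) : P.bot (c :: h) = P.bot h := by
  unfold bot; rw [highSet_cons hT]

/-- The returned index lies in `[l, r]` when all statistics behave as they should. -/
lemma answer_mem (hP : P.Valid) {l r : ℕ} (hlr : l ≤ r) (hr : r < P.B) {h : List Bool}
    (hT : P.T ≤ h.length) (hlen : Real.log P.B + 2 * P.dev + P.thr < P.rate * P.T)
    (hR : P.RightOK h r) (hL : P.LeftOK h l)
    (hlow : ∀ i, r < i → i ∉ P.lowSet h) (hhigh : ∀ i, i < l → i ∉ P.highSet h)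
    (ht1 : P.top h + 1 ≤ l → cum (P.score P.T) h < 0)
    (ht2 : r < P.top h + 1 → 0 ≤ cum (P.score P.T) h)
    (hb1 : max 1 (P.bot h) ≤ l → cum (P.score (P.T + P.N)) h < 0)
    (hb2 : r < max 1 (P.bot h) → 0 ≤ cum (P.score (P.T + P.N)) h) :
    l ≤ P.answer h ∧ P.answer h ≤ r := by
  have htop : (P.lowSet h).Nonempty → P.top h ≤ r := by
    intro hne
    by_contra hc
    exact hlow _ (not_le.1 hc) (top_mem hne)
  have hbot : (P.highSet h).Nonempty → l ≤ P.bot h := by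
    intro hne
    by_contra hc
    exact hhigh _ (not_le.1 hc) (bot_mem hne)
  unfold answer
  split_ifs with h1 h2
  · refine ⟨?_, htop h1.1⟩
    by_contra hc
    exact absurd h1.2 (not_le.2 (ht1 (by omega)))
  · refine ⟨hbot h2.1, ?_⟩
    by_contra hc
    exact absurd h2.2 (not_lt.2 (hb2 (lt_of_lt_of_le (not_le.1 hc) (le_max_right _ _))))
  -- Here `top` was rejected, so `top < r` if any index is certified low, and `r` itself competes
  -- for the infimum.
  · have hrmem : r ∈ {k | ((P.lowSet h).Nonempty → P.top h < k) ∧ P.RightOK h k} := by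
      refine ⟨fun hne => ?_, hR⟩
      by_contra hc
      exact h1 ⟨hne, ht2 (by omega)⟩
    have hk := Nat.sInf_mem ⟨r, hrmem⟩
    have hkr := Nat.sInf_le hrmem
    set k := sInf {k | ((P.lowSet h).Nonempty → P.top h < k) ∧ P.RightOK h k}
    refine ⟨?_, hkr⟩
    by_contra hc
    push Not at hc
    rcases defect_of_disjoint hP hc (by omega) hT hk.2 hL hlen with hd | hd
    · have hmem : k ∈ P.lowSet h := mem_lowSet.2 ⟨by omega, hd⟩
      have := le_top hmem
      have := hk.1 ⟨k, hmem⟩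
      omega
    · have hmem : l ∈ P.highSet h := mem_highSet.2 ⟨by omega, hd⟩
      have h3 := bot_le hmem
      -- Since `k < l`, the coin `max 1 bot` is among the low coins up to `l`, so the second test
      -- would have accepted `bot`.
      exact h2 ⟨⟨l, hmem⟩, hb1 (by omega)⟩

/-! ### Probability estimates -/

/-- The adversary flips low coins up to `l` and high coins above `r`. -/
structure Definite (P : Config) (adv : Adversary P.B) (l r : ℕ) : Prop where
  low : ∀ (h : List Bool) (j : Fin P.B), (j : ℕ) + 1 ≤ l → (adv h j : ℝ) ≤ P.a
  high : ∀ (h : List Bool) (j : Fin P.B), r < (j : ℕ) + 1 → P.b ≤ (adv h j : ℝ)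

end Config

lemma cum_mul (t : ℝ) (f : List Bool → Bool → ℝ) (h : List Bool) :
    cum (fun h c => t * f h c) h = t * cum f h := by
  induction h with
  | nil => simp
  | cons c h ih => simp only [cum_cons, ih]; ring

lemma mean_const (x y : ℝ) : mean x (fun _ => y) = y := by unfold mean; ring

lemma mean_sum {ι : Type*} (x : ℝ) (s : Finset ι) (G : ι → Bool → ℝ) :
    mean x (fun c => ∑ i ∈ s, G i c) = ∑ i ∈ s, mean x (G i) := by
  unfold mean
  rw [Finset.sum_add_distrib, Finset.mul_sum, Finset.mul_sum]

/-- If at most one term of a finite sum moves, and its mean grows by at most `d`, so does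
the sum. -/
lemma mean_sum_le {ι : Type*} [DecidableEq ι] {x d : ℝ} (hd : 0 ≤ d) (s : Finset ι)
    (G : ι → Bool → ℝ) (g : ι → ℝ) (i₀ : ι) (h0 : mean x (G i₀) ≤ g i₀ + d)
    (h : ∀ i ∈ s, i ≠ i₀ → ∀ c, G i c = g i) :
    mean x (fun c => ∑ i ∈ s, G i c) ≤ ∑ i ∈ s, g i + d := by
  rw [mean_sum]
  have key : ∀ i ∈ s, mean x (G i) ≤ g i + if i = i₀ then d else 0 := by
    intro i hi
    by_cases hii : i = i₀
    · subst hii; simpa using h0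
    · have : G i = fun _ => g i := funext (h i hi hii)
      rw [this, mean_const]; simp [hii]
  refine (Finset.sum_le_sum key).trans ?_
  rw [Finset.sum_add_distrib, Finset.sum_ite_eq' s i₀]
  split_ifs <;> linarith

namespace Config

variable {P : Config} {adv : Adversary P.B} {l r : ℕ} {C t : ℝ}

lemma Definite.high_of_lt (hd : P.Definite adv l r) (hP : P.Valid) {h : List Bool}
    (hf : r < P.flip h) : P.b ≤ (adv h ((P.algorithm hP.B_pos).query h) : ℝ) :=
  hd.high h _ (by rw [query_val hP]; exact hf)

lemma Definite.low_of_le (hd : P.Definite adv l r) (hP : P.Valid) {h : List Bool}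
    (hf : P.flip h ≤ l) : (adv h ((P.algorithm hP.B_pos).query h) : ℝ) ≤ P.a :=
  hd.low h _ (by rw [query_val hP]; exact hf)

lemma flip_of_lt {h : List Bool} (hT : h.length < P.T) : P.flip h = P.coin h := if_pos hT

/-- Chernoff's bound for the lower tail of a statistic. -/
lemma prob_cum_lt_le (hP : P.Valid) (f : List Bool → Bool → ℝ) (n : ℕ) (ht : 0 < t)
    (hstep : ∀ h, mean (adv h ((P.algorithm hP.B_pos).query h))
      (fun c => Real.exp (-t * f h c)) ≤ 1) :
    ((P.algorithm hP.B_pos).history adv n).toOuterMeasure {h | cum f h < -P.dev} ≤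
      ENNReal.ofReal (Real.exp (-(t * P.dev))) := by
  refine le_trans ?_ (prob_cum_ge_le (P.algorithm hP.B_pos) adv n (fun h c => -t * f h c)
    (t * P.dev) (fun h _ => hstep h))
  apply MeasureTheory.measure_mono
  intro h (hh : cum f h < -P.dev)
  show t * P.dev ≤ _
  rw [cum_mul]
  nlinarith

lemma mean_full_le {x y : ℝ} (hy0 : 0 < y) (hy1 : y < 1) (hP : P.Valid)
    (h : 0 ≤ (x - y) * (y - P.s)) (hys : y ≠ P.s) (ht0 : 0 ≤ t)
    (ht1 : t ≤ 1 / 2) (hC : kl y P.s = C) (habs : ∀ c, |Real.log (bern y c / bern P.s c)| ≤ 2)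
    (hvar : mean y (fun c => Real.log (bern y c / bern P.s c) ^ 2) ≤ 144 * C)
    (hrate : P.rate = C * (1 - 144 * t)) :
    mean x (fun c => Real.exp (-t * (Real.log (bern y c / bern P.s c) - P.rate))) ≤ 1 := by
  have h1 := mean_exp_neg_le hy0 hy1 hP.s_pos hP.s_lt h hys ht0 ht1 hC habs hvar
  have h2 := mul_le_mul_of_nonneg_left h1 (Real.exp_pos (t * P.rate)).le
  rw [← Real.exp_add, ← hrate, add_neg_cancel, Real.exp_zero] at h2
  refine le_trans (le_of_eq ?_) h2
  have e : ∀ c, Real.exp (-t * (Real.log (bern y c / bern P.s c) - P.rate))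
      = Real.exp (t * P.rate) * Real.exp (-(t * Real.log (bern y c / bern P.s c))) := by
    intro c; rw [← Real.exp_add]; ring_nf
  simp only [e]
  unfold mean; ring

lemma mean_b_le (hP : P.Valid) (hch : Channel P.a P.b P.s C) (ht0 : 0 ≤ t) (ht1 : t ≤ 1 / 2)
    (hrate : P.rate = C * (1 - 144 * t)) {x : ℝ} (hx : P.b ≤ x) :
    mean x (fun c => Real.exp (-t * (Real.log (bern P.b c / bern P.s c) - P.rate))) ≤ 1 :=
  mean_full_le hP.b_pos hP.b_lt hP (mul_nonneg (by linarith) (by linarith [hP.lt_b])) hP.lt_b.ne'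
    ht0 ht1 hch.kl_b hch.abs_b hch.var_b hrate

lemma mean_a_le (hP : P.Valid) (hch : Channel P.a P.b P.s C) (ht0 : 0 ≤ t) (ht1 : t ≤ 1 / 2)
    (hrate : P.rate = C * (1 - 144 * t)) {x : ℝ} (hx : x ≤ P.a) :
    mean x (fun c => Real.exp (-t * (Real.log (bern P.a c / bern P.s c) - P.rate))) ≤ 1 :=
  mean_full_le hP.a_pos hP.a_lt_one hP
    (mul_nonneg_of_nonpos_of_nonpos (by linarith) (by linarith [hP.a_lt])) hP.a_lt.ne
    ht0 ht1 hch.kl_a hch.abs_a hch.var_a hrate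

lemma prob_rightFull_le (hP : P.Valid) (hd : P.Definite adv l r) (hch : Channel P.a P.b P.s C)
    (ht0 : 0 < t) (ht1 : t ≤ 1 / 2) (hrate : P.rate = C * (1 - 144 * t)) (n : ℕ) :
    ((P.algorithm hP.B_pos).history adv n).toOuterMeasure
      {h | cum (P.rightFull r) h < -P.dev} ≤ ENNReal.ofReal (Real.exp (-(t * P.dev))) := by
  refine prob_cum_lt_le hP _ n ht0 fun h => ?_
  unfold rightFull
  by_cases hc : h.length < P.T ∧ r < P.coin h
  · simp only [hc, and_self, if_true]
    exact mean_b_le hP hch ht0.le ht1 hrate (hd.high_of_lt hP (by rw [flip_of_lt hc.1]; exact hc.2))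
  · simp [hc, mean_const]

lemma prob_leftFull_le (hP : P.Valid) (hd : P.Definite adv l r) (hch : Channel P.a P.b P.s C)
    (ht0 : 0 < t) (ht1 : t ≤ 1 / 2) (hrate : P.rate = C * (1 - 144 * t)) (n : ℕ) :
    ((P.algorithm hP.B_pos).history adv n).toOuterMeasure
      {h | cum (P.leftFull l) h < -P.dev} ≤ ENNReal.ofReal (Real.exp (-(t * P.dev))) := by
  refine prob_cum_lt_le hP _ n ht0 fun h => ?_
  unfold leftFull
  by_cases hc : h.length < P.T ∧ P.coin h ≤ l
  · simp only [hc, and_self, if_true]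
    exact mean_a_le hP hch ht0.le ht1 hrate (hd.low_of_le hP (by rw [flip_of_lt hc.1]; exact hc.2))
  · simp [hc, mean_const]

lemma prob_rightGain_le (hP : P.Valid) (hd : P.Definite adv l r) (hch : Channel P.a P.b P.s C)
    (ht0 : 0 < t) (ht1 : t ≤ 1 / 2) (hrate : P.rate = C * (1 - 144 * t)) (n : ℕ) :
    ((P.algorithm hP.B_pos).history adv n).toOuterMeasure
      {h | cum (P.rightGain r) h < -P.dev} ≤ ENNReal.ofReal (Real.exp (-(t * P.dev))) := by
  refine prob_cum_lt_le hP _ n ht0 fun h => ?_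
  unfold rightGain
  by_cases hc : h.length < P.T ∧ r < P.coin h
  · have hx := hd.high_of_lt hP (h := h) (by rw [flip_of_lt hc.1]; exact hc.2)
    simp only [hc, and_self, if_true]
    -- A split `r` predicts something between `s` and `b`: its gain has no guaranteed rate, but the
    -- tilted likelihood ratio is still a supermartingale. An unsplit `r` predicts `b` and earns the
    -- full rate.
    by_cases ha : P.atom h = r
    · simp only [ha, if_true, sub_zero, neg_mul]
      refine mean_exp_neg_le_one (unitInterval.nonneg _) (unitInterval.le_one _)
        (level_pos hP h r) (level_lt hP h r) hP.s_pos hP.s_lt (mul_nonneg ?_ ?_) ht0.le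
        (by linarith)
      · linarith [(level_mem hP h r).2]
      · linarith [le_level_of_lt_coin hP hc.2]
    · have : r < P.atom h := by rcases coin_cases (P := P) h with e | e <;> omega
      simp only [ha, if_false, level_of_lt this]
      exact mean_b_le hP hch ht0.le ht1 hrate hx
  · simp [hc, mean_const]

lemma prob_leftGain_le (hP : P.Valid) (hd : P.Definite adv l r) (hch : Channel P.a P.b P.s C)
    (ht0 : 0 < t) (ht1 : t ≤ 1 / 2) (hrate : P.rate = C * (1 - 144 * t)) (n : ℕ) :
    ((P.algorithm hP.B_pos).history adv n).toOuterMeasure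
      {h | cum (P.leftGain l) h < -P.dev} ≤ ENNReal.ofReal (Real.exp (-(t * P.dev))) := by
  refine prob_cum_lt_le hP _ n ht0 fun h => ?_
  unfold leftGain
  by_cases hc : h.length < P.T ∧ P.coin h ≤ l
  · have hx := hd.low_of_le hP (h := h) (by rw [flip_of_lt hc.1]; exact hc.2)
    simp only [hc, and_self, if_true]
    by_cases ha : P.atom h = l
    · simp only [ha, if_true, sub_zero, neg_mul]
      refine mean_exp_neg_le_one (unitInterval.nonneg _) (unitInterval.le_one _)
        (level_pos hP h l) (level_lt hP h l) hP.s_pos hP.s_lt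
        (mul_nonneg_of_nonpos_of_nonpos ?_ ?_) ht0.le (by linarith)
      · linarith [(level_mem hP h l).1]
      · linarith [level_le_of_coin_le hP hc.2]
    · have : P.atom h < l := by rcases coin_cases (P := P) h with e | e <;> omega
      simp only [ha, if_false, level_of_gt this]
      exact mean_a_le hP hch ht0.le ht1 hrate hx
  · simp [hc, mean_const]

/-- Markov's inequality for the sum of `penalty (lowDefect i)` over all `i > r`. The sum starts at
zero, and each flip moves at most the term of the quantile index, with drift at most `kl b a ≤ 48
C`; the number of indices therefore does not enter. -/
lemma prob_lowSet_le (hP : P.Valid) (hd : P.Definite adv l r) (hch : Channel P.a P.b P.s C)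
    (hthr : 0 < penalty P.thr) (n : ℕ) :
    ((P.algorithm hP.B_pos).history adv n).toOuterMeasure {h | ∃ i, r < i ∧ i ∈ P.lowSet h} ≤
      ENNReal.ofReal (n * (48 * C) / penalty P.thr) := by
  have hC := hch.C_pos
  set S := (Finset.range P.B).filter fun i => r < i with hS
  have h1 := prob_history_ge_le (P.algorithm hP.B_pos) adv n
    (fun h => ∑ i ∈ S, penalty (cum (P.lowDefect i) h)) (48 * C) (penalty P.thr) (by positivity)
    hthr (fun h => Finset.sum_nonneg fun i _ => penalty_nonneg _) (fun h _ => by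
      by_cases hc : h.length < P.T ∧ P.coin h = P.atom h ∧ r < P.atom h
      · refine mean_sum_le (by positivity) S (fun i c => penalty (cum (P.lowDefect i) (c :: h)))
          (fun i => penalty (cum (P.lowDefect i) h)) (P.atom h) ?_ ?_
        · have hx := hd.high_of_lt hP (h := h) (by rw [flip_of_lt hc.1]; omega)
          have hm := level_mem hP h (P.atom h)
          simp only [cum_cons, lowDefect, hc, and_self, if_true]
          have := mean_penalty_le (p := (adv h ((P.algorithm hP.B_pos).query h) : ℝ)) (x := P.b)
            (y := P.level h (P.atom h)) (z := P.a) (e := cum (P.lowDefect (P.atom h)) h)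
            hP.b_pos hP.b_lt (level_pos hP h _) (level_lt hP h _) hP.a_pos hP.a_lt_one
            (mul_nonneg (by linarith) (by linarith)) (mul_nonneg (by linarith) (by linarith))
          exact this.trans (by linarith [hch.kl_ba])
        · intro i _ hi c
          have : ¬ (P.atom h = i) := fun e => hi e.symm
          simp [lowDefect, this]
      · have : ∀ i ∈ S, ∀ c, penalty (cum (P.lowDefect i) (c :: h))
            = penalty (cum (P.lowDefect i) h) := by
          intro i hi c
          have hri := (Finset.mem_filter.1 hi).2
          have : ¬ (h.length < P.T ∧ P.atom h = i ∧ P.coin h = i) := by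
            rintro ⟨h1, rfl, h3⟩; exact hc ⟨h1, h3, hri⟩
          simp [lowDefect, this]
        rw [mean_sum]
        have : ∑ i ∈ S, mean (adv h ((P.algorithm hP.B_pos).query h))
            (fun c => penalty (cum (P.lowDefect i) (c :: h)))
            = ∑ i ∈ S, penalty (cum (P.lowDefect i) h) :=
          Finset.sum_congr rfl fun i hi => by
            rw [funext (this i hi), mean_const]
        rw [this]
        linarith)
  simp only [cum_nil, penalty_zero, Finset.sum_const_zero, zero_add] at h1
  refine le_trans ?_ h1
  apply MeasureTheory.measure_mono
  rintro h ⟨i, hri, hi⟩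
  obtain ⟨hiB, hi⟩ := mem_lowSet.1 hi
  exact (penalty_mono hi).trans (Finset.single_le_sum
    (f := fun i => penalty (cum (P.lowDefect i) h)) (fun j _ => penalty_nonneg _)
    (by simp [hS, hiB, hri]))

lemma prob_highSet_le (hP : P.Valid) (hd : P.Definite adv l r) (hch : Channel P.a P.b P.s C)
    (hthr : 0 < penalty P.thr) (n : ℕ) :
    ((P.algorithm hP.B_pos).history adv n).toOuterMeasure {h | ∃ i, i < l ∧ i ∈ P.highSet h} ≤
      ENNReal.ofReal (n * (48 * C) / penalty P.thr) := by
  have hC := hch.C_pos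
  set S := (Finset.range P.B).filter fun i => i < l with hS
  have h1 := prob_history_ge_le (P.algorithm hP.B_pos) adv n
    (fun h => ∑ i ∈ S, penalty (cum (P.highDefect i) h)) (48 * C) (penalty P.thr) (by positivity)
    hthr (fun h => Finset.sum_nonneg fun i _ => penalty_nonneg _) (fun h _ => by
      by_cases hc : h.length < P.T ∧ P.coin h = P.atom h + 1 ∧ P.atom h < l
      · refine mean_sum_le (by positivity) S (fun i c => penalty (cum (P.highDefect i) (c :: h)))
          (fun i => penalty (cum (P.highDefect i) h)) (P.atom h) ?_ ?_
        · have hx := hd.low_of_le hP (h := h) (by rw [flip_of_lt hc.1]; omega)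
          have hm := level_mem hP h (P.atom h)
          simp only [cum_cons, highDefect, hc, and_self, if_true]
          have := mean_penalty_le (p := (adv h ((P.algorithm hP.B_pos).query h) : ℝ)) (x := P.a)
            (y := P.level h (P.atom h)) (z := P.b) (e := cum (P.highDefect (P.atom h)) h)
            hP.a_pos hP.a_lt_one (level_pos hP h _) (level_lt hP h _) hP.b_pos hP.b_lt
            (mul_nonneg_of_nonpos_of_nonpos (by linarith) (by linarith))
            (mul_nonneg_of_nonpos_of_nonpos (by linarith) (by linarith))
          exact this.trans (by linarith [hch.kl_ab])
        · intro i _ hi c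
          have : ¬ (P.atom h = i) := fun e => hi e.symm
          simp [highDefect, this]
      · have : ∀ i ∈ S, ∀ c, penalty (cum (P.highDefect i) (c :: h))
            = penalty (cum (P.highDefect i) h) := by
          intro i hi c
          have hri := (Finset.mem_filter.1 hi).2
          have : ¬ (h.length < P.T ∧ P.atom h = i ∧ P.coin h = i + 1) := by
            rintro ⟨h1, rfl, h3⟩; exact hc ⟨h1, h3, hri⟩
          simp [highDefect, this]
        rw [mean_sum]
        have : ∑ i ∈ S, mean (adv h ((P.algorithm hP.B_pos).query h))
            (fun c => penalty (cum (P.highDefect i) (c :: h)))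
            = ∑ i ∈ S, penalty (cum (P.highDefect i) h) :=
          Finset.sum_congr rfl fun i hi => by
            rw [funext (this i hi), mean_const]
        rw [this]
        linarith)
  simp only [cum_nil, penalty_zero, Finset.sum_const_zero, zero_add] at h1
  refine le_trans ?_ h1
  apply MeasureTheory.measure_mono
  rintro h ⟨i, hri, hi⟩
  obtain ⟨hiB, hi⟩ := mem_highSet.1 hi
  exact (penalty_mono hi).trans (Finset.single_le_sum
    (f := fun i => penalty (cum (P.highDefect i) h)) (fun j _ => penalty_nonneg _)
    (by simp [hS, hiB, hri]))

/-! ### The final tests -/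

open Classical in
/-- Exponent of the test starting at time `u`, run under the hypothesis `Q`. -/
def testExponent (P : Config) (u : ℕ) (Q : List Bool → Prop) (σ κ : ℝ) (h : List Bool) (c : Bool) :
    ℝ :=
  if u ≤ h.length ∧ h.length < u + P.N ∧ Q h then
    σ * Real.log (bern P.b c / bern P.a c) + κ else 0

/-- The condition `Q` cannot change once the test has begun, so the exponent is active during the
whole test or never. One supermartingale thus handles a test whose coin depends on the history. -/
lemma cum_testExponent {u : ℕ} {Q : List Bool → Prop} (σ κ : ℝ)
    (hQ : ∀ c h, u ≤ h.length → (Q (c :: h) ↔ Q h)) (h : List Bool) :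
    (h.length ≤ u → cum (P.testExponent u Q σ κ) h = 0 ∧ cum (P.score u) h = 0) ∧
    (u ≤ h.length → Q h → cum (P.testExponent u Q σ κ) h
      = σ * cum (P.score u) h + κ * (min h.length (u + P.N) - u : ℕ)) := by
  induction h with
  | nil =>
    refine ⟨fun _ => by simp, fun hu _ => ?_⟩
    simp at hu; subst hu; simp
  | cons c h ih =>
    simp only [cum_cons, List.length_cons]
    constructor
    · intro hu
      obtain ⟨h1, h2⟩ := ih.1 (by omega)
      rw [h1, h2]
      have : ¬ u ≤ h.length := by omega
      simp [testExponent, score, this]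
    · intro hu hq
      rcases Nat.lt_or_ge h.length u with hlt | hge
      · obtain ⟨h1, h2⟩ := ih.1 (by omega)
        rw [h1, h2]
        have : ¬ u ≤ h.length := by omega
        have e : min (h.length + 1) (u + P.N) - u = 0 := by omega
        simp [testExponent, score, this, e]
      · have hq' := (hQ c h hge).1 hq
        rw [ih.2 hge hq']
        by_cases hN : h.length < u + P.N
        · have e : min (h.length + 1) (u + P.N) - u = (min h.length (u + P.N) - u) + 1 := by omega
          rw [e]
          simp only [testExponent, score, hge, hN, hq', and_self, if_true]
          push_cast; ring
        · have e : min (h.length + 1) (u + P.N) - u = min h.length (u + P.N) - u := by omega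
          rw [e]
          simp [testExponent, score, hN]

/-- A test of the wrong sign on a low coin is unlikely. -/
lemma prob_test_low_le (hP : P.Valid) (hd : P.Definite adv l r) (hch : Channel P.a P.b P.s C)
    {u n : ℕ} (hn : u + P.N ≤ n) {f : List Bool → ℕ} (hf : ∀ c h, u ≤ h.length → f (c :: h) = f h)
    (hflip : ∀ h, u ≤ h.length → h.length < u + P.N → P.flip h = f h) :
    ((P.algorithm hP.B_pos).history adv n).toOuterMeasure
      {h | h.length = n ∧ f h ≤ l ∧ 0 ≤ cum (P.score u) h} ≤
      ENNReal.ofReal (Real.exp (-(P.N * (C / 32)))) := by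
  refine le_trans ?_ (prob_cum_ge_le (P.algorithm hP.B_pos) adv n
    (P.testExponent u (fun h => f h ≤ l) (1 / 2) (C / 32)) (P.N * (C / 32)) (fun h _ => ?_))
  · apply MeasureTheory.measure_mono
    rintro h ⟨hlen, hfl, hs⟩
    have := (cum_testExponent (P := P) (u := u) (Q := fun h => f h ≤ l) (1 / 2) (C / 32)
      (fun c h hu => by rw [hf c h hu]) h).2 (by omega) hfl
    show _ ≤ cum _ h
    have e : min h.length (u + P.N) - u = P.N := by omega
    rw [this, e]
    nlinarith
  · unfold testExponent
    by_cases hc : u ≤ h.length ∧ h.length < u + P.N ∧ f h ≤ l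
    · simp only [hc, and_self, if_true]
      have hx := hd.low_of_le hP (h := h) (by rw [hflip h hc.1 hc.2.1]; exact hc.2.2)
      have h1 := (mean_exp_half_le (p := (adv h ((P.algorithm hP.B_pos).query h) : ℝ)) (y := P.b)
        (z := P.a) hP.b_pos hP.b_lt hP.a_pos hP.a_lt_one
        (mul_nonneg_of_nonpos_of_nonpos (by linarith) (by linarith [hP.a_lt_b])))
      rw [mul_comm P.b, mul_comm (1 - P.b)] at h1
      have h2 := mul_le_mul_of_nonneg_right (h1.trans hch.affinity) (Real.exp_pos (C / 32)).le
      rw [← Real.exp_add, neg_add_cancel, Real.exp_zero] at h2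
      refine le_trans (le_of_eq ?_) h2
      simp only [Real.exp_add]
      unfold mean; ring
    · simp [hc, mean_const]

/-- A test of the wrong sign on a high coin is unlikely. -/
lemma prob_test_high_le (hP : P.Valid) (hd : P.Definite adv l r) (hch : Channel P.a P.b P.s C)
    {u n : ℕ} (hn : u + P.N ≤ n) {f : List Bool → ℕ} (hf : ∀ c h, u ≤ h.length → f (c :: h) = f h)
    (hflip : ∀ h, u ≤ h.length → h.length < u + P.N → P.flip h = f h) :
    ((P.algorithm hP.B_pos).history adv n).toOuterMeasure
      {h | h.length = n ∧ r < f h ∧ cum (P.score u) h < 0} ≤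
      ENNReal.ofReal (Real.exp (-(P.N * (C / 32)))) := by
  refine le_trans ?_ (prob_cum_ge_le (P.algorithm hP.B_pos) adv n
    (P.testExponent u (fun h => r < f h) (-(1 / 2)) (C / 32)) (P.N * (C / 32)) (fun h _ => ?_))
  · apply MeasureTheory.measure_mono
    rintro h ⟨hlen, hfl, hs⟩
    have := (cum_testExponent (P := P) (u := u) (Q := fun h => r < f h) (-(1 / 2)) (C / 32)
      (fun c h hu => by rw [hf c h hu]) h).2 (by omega) hfl
    show _ ≤ cum _ h
    have e : min h.length (u + P.N) - u = P.N := by omega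
    rw [this, e]
    nlinarith
  · unfold testExponent
    by_cases hc : u ≤ h.length ∧ h.length < u + P.N ∧ r < f h
    · simp only [hc, and_self, if_true]
      have hx := hd.high_of_lt hP (h := h) (by rw [hflip h hc.1 hc.2.1]; exact hc.2.2)
      have h1 := (mean_exp_half_le (p := (adv h ((P.algorithm hP.B_pos).query h) : ℝ)) (y := P.a)
        (z := P.b) hP.a_pos hP.a_lt_one hP.b_pos hP.b_lt
        (mul_nonneg (by linarith) (by linarith [hP.a_lt_b])))
      have h2 := mul_le_mul_of_nonneg_right (h1.trans hch.affinity) (Real.exp_pos (C / 32)).le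
      rw [← Real.exp_add, neg_add_cancel, Real.exp_zero] at h2
      refine le_trans (le_of_eq ?_) h2
      have e : ∀ c, Real.exp (-(1 / 2) * Real.log (bern P.b c / bern P.a c) + C / 32)
          = Real.exp (1 / 2 * Real.log (bern P.a c / bern P.b c)) * Real.exp (C / 32) := by
        intro c
        rw [← Real.exp_add, ← inv_div (bern P.b c), Real.log_inv]; ring_nf
      simp only [e]
      unfold mean; ring
    · simp [hc, mean_const]

/-- The index returned by the search lies in `[l, r]` with probability at least `1 - β`. -/
lemma exists_bad_set (hP : P.Valid) (hd : P.Definite adv l r) (hch : Channel P.a P.b P.s C)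
    (hlr : l ≤ r) (hr : r < P.B) (ht0 : 0 < t) (ht1 : t ≤ 1 / 2)
    (hrate : P.rate = C * (1 - 144 * t)) {β : ℝ}
    (hlen : Real.log P.B + 2 * P.dev + P.thr < P.rate * P.T)
    (hdev : Real.exp (-(t * P.dev)) ≤ β / 10) (hN : Real.exp (-(P.N * (C / 32))) ≤ β / 10)
    (hthr : 0 < penalty P.thr)
    (hpen : ((P.T + 2 * P.N : ℕ) : ℝ) * (48 * C) / penalty P.thr ≤ β / 10) :
    ∃ S : Set (List Bool), ((P.algorithm hP.B_pos).history adv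
        (P.algorithm hP.B_pos).flips).toOuterMeasure S ≤ ENNReal.ofReal β ∧
      ∀ h, h.length = (P.algorithm hP.B_pos).flips → h ∉ S →
        l ≤ P.answer h ∧ P.answer h ≤ r := by
  have hfl : (P.algorithm hP.B_pos).flips = P.T + 2 * P.N := rfl
  rw [hfl]
  set n := P.T + 2 * P.N with hn
  set μ := ((P.algorithm hP.B_pos).history adv n).toOuterMeasure with hμ
  have f1 : ∀ h : List Bool, P.T ≤ h.length → h.length < P.T + P.N → P.flip h = P.top h + 1 := by
    intro h h1 h2
    unfold flip
    rw [if_neg (by omega), if_pos h2]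
  have f2 : ∀ h : List Bool, P.T + P.N ≤ h.length → h.length < P.T + P.N + P.N →
      P.flip h = max 1 (P.bot h) := by
    intro h h1 h2
    unfold flip
    rw [if_neg (by omega), if_neg (by omega)]
  have g1 : ∀ c (h : List Bool), P.T ≤ h.length → P.top (c :: h) + 1 = P.top h + 1 :=
    fun c h hh => by rw [top_cons hh]
  have g2 : ∀ c (h : List Bool), P.T + P.N ≤ h.length →
      max 1 (P.bot (c :: h)) = max 1 (P.bot h) := fun c h hh => by rw [bot_cons (by omega)]
  let E : Fin 10 → Set (List Bool) := ![{h | cum (P.rightFull r) h < -P.dev},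
    {h | cum (P.rightGain r) h < -P.dev}, {h | cum (P.leftFull l) h < -P.dev},
    {h | cum (P.leftGain l) h < -P.dev}, {h | ∃ i, r < i ∧ i ∈ P.lowSet h},
    {h | ∃ i, i < l ∧ i ∈ P.highSet h},
    {h | h.length = n ∧ P.top h + 1 ≤ l ∧ 0 ≤ cum (P.score P.T) h},
    {h | h.length = n ∧ r < P.top h + 1 ∧ cum (P.score P.T) h < 0},
    {h | h.length = n ∧ max 1 (P.bot h) ≤ l ∧ 0 ≤ cum (P.score (P.T + P.N)) h},
    {h | h.length = n ∧ r < max 1 (P.bot h) ∧ cum (P.score (P.T + P.N)) h < 0}]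
  have hE : ∀ i, μ (E i) ≤ ENNReal.ofReal (β / 10) := by
    have c1 := ENNReal.ofReal_le_ofReal hdev
    have c2 := ENNReal.ofReal_le_ofReal hN
    have c3 := ENNReal.ofReal_le_ofReal hpen
    intro i
    fin_cases i
    · exact (prob_rightFull_le hP hd hch ht0 ht1 hrate n).trans c1
    · exact (prob_rightGain_le hP hd hch ht0 ht1 hrate n).trans c1
    · exact (prob_leftFull_le hP hd hch ht0 ht1 hrate n).trans c1
    · exact (prob_leftGain_le hP hd hch ht0 ht1 hrate n).trans c1
    · exact (prob_lowSet_le hP hd hch hthr n).trans c3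
    · exact (prob_highSet_le hP hd hch hthr n).trans c3
    · exact (prob_test_low_le hP hd hch (by omega) g1 f1).trans c2
    · exact (prob_test_high_le hP hd hch (by omega) g1 f1).trans c2
    · exact (prob_test_low_le hP hd hch (by omega) g2 f2).trans c2
    · exact (prob_test_high_le hP hd hch (by omega) g2 f2).trans c2
  refine ⟨⋃ i, E i, ?_, ?_⟩
  · refine (MeasureTheory.measure_iUnion_fintype_le μ E).trans ?_
    refine (Finset.sum_le_sum fun i _ => hE i).trans ?_
    rw [Finset.sum_const, Finset.card_univ, Fintype.card_fin, nsmul_eq_mul,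
      ← ENNReal.ofReal_natCast, ← ENNReal.ofReal_mul (by positivity)]
    apply ENNReal.ofReal_le_ofReal
    push_cast; linarith
  · intro h hh hS
    have hS' : ∀ i, h ∉ E i := fun i hi => hS (Set.mem_iUnion.2 ⟨i, hi⟩)
    have s0 := hS' 0
    have s1 := hS' 1
    have s2 := hS' 2
    have s3 := hS' 3
    have s4 := hS' 4
    have s5 := hS' 5
    have s6 := hS' 6
    have s7 := hS' 7
    have s8 := hS' 8
    have s9 := hS' 9
    refine answer_mem hP hlr hr (by omega) hlen ⟨not_lt.1 s1, not_lt.1 s0⟩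
      ⟨not_lt.1 s3, not_lt.1 s2⟩ (fun i h1 h2 => s4 ⟨i, h1, h2⟩) (fun i h1 h2 => s5 ⟨i, h1, h2⟩)
      (fun h1 => ?_) (fun h1 => ?_) (fun h1 => ?_) (fun h1 => ?_)
    · exact not_le.1 fun h2 => s6 ⟨hh, h1, h2⟩
    · exact not_lt.1 fun h2 => s7 ⟨hh, h1, h2⟩
    · exact not_le.1 fun h2 => s8 ⟨hh, h1, h2⟩
    · exact not_lt.1 fun h2 => s9 ⟨hh, h1, h2⟩

end Config

/-! ### Good indices -/

/-- The good indices of an instance contain an interval `[l, r]` such that the adversary has to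
flip coins of head probability at most `τ - α` up to `l`, and at least `τ + α` above `r`. -/
lemma exists_good_interval {B : ℕ} {p : Fin (B + 1) → ℝ} (hp : IsInstance p) {τ α c : ℝ}
    (hα : 0 < α) (hc : 0 ≤ c) (hlo : α * (1 + c) ≤ τ) (hhi : α * (1 + c) ≤ 1 - τ)
    {adv : Adversary B} (hadv : adv.IsBounded p (c * α)) :
    ∃ l r : ℕ, l ≤ r ∧ r < B ∧
      (∀ h (j : Fin B), (j : ℕ) + 1 ≤ l → (adv h j : ℝ) ≤ τ - α) ∧
      (∀ h (j : Fin B), r < (j : ℕ) + 1 → τ + α ≤ (adv h j : ℝ)) ∧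
      ∀ i : Fin B, l ≤ i → (i : ℕ) ≤ r → IsGood p τ (α * (1 + c)) i := by
  have hr : 0 < α * (1 + c) := by positivity
  obtain ⟨L, hL, hLmax⟩ := (Finset.univ.filter fun i => p i ≤ τ - α * (1 + c)).exists_max_image id
    ⟨0, by simp [hp.first, hlo]⟩
  obtain ⟨R, hR, hRmin⟩ := (Finset.univ.filter fun i => τ + α * (1 + c) ≤ p i).exists_min_image id
    ⟨Fin.last B, by simp only [Finset.mem_filter, Finset.mem_univ, hp.last, true_and]; linarith⟩
  simp only [Finset.mem_filter, Finset.mem_univ, true_and, id] at hL hR hLmax hRmin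
  have hLR : L < R := by
    by_contra hcon
    have := hp.mono (not_lt.1 hcon)
    linarith
  have hLR' : (L : ℕ) < R := hLR
  have hRB := R.isLt
  -- `L` is the last position at or below the good window and `R` the first at or above it. Of the
  -- margin `α (1 + c)`, the adversary can take back at most `c α`, leaving `α`.
  refine ⟨L, R - 1, by omega, by omega, fun h j hj => ?_, fun h j hj => ?_, fun i hli hir => ?_⟩
  · have h1 : p j.succ ≤ p L := hp.mono (by rw [Fin.le_def, Fin.val_succ]; exact hj)
    have h2 := (abs_le.1 (hadv h j)).2
    linarith
  · have h1 : p R ≤ p j.succ := hp.mono (by rw [Fin.le_def, Fin.val_succ]; omega)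
    have h2 := (abs_le.1 (hadv h j)).1
    linarith
  · have h1 : p i.castSucc < τ + α * (1 + c) := by
      by_contra hcon
      have := Fin.le_def.1 (hRmin _ (not_lt.1 hcon))
      rw [Fin.val_castSucc] at this
      omega
    have h2 : τ - α * (1 + c) < p i.succ := by
      by_contra hcon
      have := Fin.le_def.1 (hLmax _ (not_lt.1 hcon))
      rw [Fin.val_succ] at this
      omega
    have h3 : p i.castSucc ≤ p i.succ := hp.mono (Fin.castSucc_le_succ i)
    rcases lt_or_ge (τ - α * (1 + c)) (p i.castSucc) with h4 | h4
    · exact ⟨p i.castSucc, ⟨le_rfl, h3⟩, h4, h1⟩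
    rcases lt_or_ge (p i.succ) (τ + α * (1 + c)) with h5 | h5
    · exact ⟨p i.succ, ⟨h3, le_rfl⟩, h2, h5⟩
    · exact ⟨τ, ⟨by linarith, by linarith⟩, by linarith, by linarith⟩

lemma mul_one_add_le_of_le_half_min {τ α c : ℝ} (hα : 0 < α) (hατ : α ≤ 1 / 2 * min τ (1 - τ))
    (hc1 : c ≤ 1) : α * (1 + c) ≤ τ ∧ α * (1 + c) ≤ 1 - τ := by
  have h1 : α * (1 + c) ≤ α * 2 := mul_le_mul_of_nonneg_left (by linarith) hα.le
  have h2 := min_le_left τ (1 - τ)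
  have h3 := min_le_right τ (1 - τ)
  constructor <;> linarith

/-- A single coin needs no flips. -/
lemma exists_solves_one {τ α c β : ℝ} (hα : 0 < α) (hατ : α ≤ 1 / 2 * min τ (1 - τ))
    (hc0 : 0 ≤ c) (hc1 : c ≤ 1) (hβ : 0 ≤ β) :
    ∃ A : Algorithm 1, A.flips = 0 ∧ A.Solves τ α c β := by
  obtain ⟨hlo, hhi⟩ := mul_one_add_le_of_le_half_min hα hατ hc1
  refine ⟨⟨0, fun _ => 0, fun _ => 0⟩, rfl, solves_of_prob_le _ hβ fun p hp adv hadv => ?_⟩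
  obtain ⟨l, r, hlr, hr, -, -, hgood⟩ := exists_good_interval hp hα hc0 hlo hhi hadv
  exact ⟨∅, by simp, fun h _ _ => hgood 0 (by simp; omega) (by simp)⟩

/-! ### Choice of the parameters -/

/-- Parameters of the search: `A` is the logarithm of the number of coins, `exp (-D)` the
failure probability and `C` the capacity. -/
structure Parameters (A D C : ℝ) where
  t : ℝ
  dev : ℝ
  thr : ℝ
  T : ℕ
  N : ℕ
  t_pos : 0 < t
  t_le : t ≤ 1 / 288
  length : A + 2 * dev + thr < C * (1 - 144 * t) * T
  deviation : Real.exp (-(t * dev)) ≤ Real.exp (-D) / 10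
  tests : Real.exp (-(N * (C / 32))) ≤ Real.exp (-D) / 10
  penalty_pos : 0 < penalty thr
  certificates : ((T + 2 * N : ℕ) : ℝ) * (48 * C) / penalty thr ≤ Real.exp (-D) / 10

lemma exp_le_two_mul_penalty {x : ℝ} (hx : 3 ≤ x) : Real.exp x ≤ 2 * penalty x := by
  have h0 : 0 ≤ x := by linarith
  rw [penalty, if_pos h0]
  have := Real.quadratic_le_exp_of_nonneg h0
  nlinarith

lemma exp_neg_le_div_ten {D M x : ℝ} (hM : Real.log 10 ≤ M * D) (hx : (1 + M) * D ≤ x) :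
    Real.exp (-x) ≤ Real.exp (-D) / 10 := by
  have : Real.exp (-D) / 10 = Real.exp (-(D + Real.log 10)) := by
    rw [neg_add, Real.exp_add, Real.exp_neg (Real.log 10), Real.exp_log (by norm_num)]
    ring
  rw [this, Real.exp_le_exp]
  linarith

/-- A length that is linear in `R` with slope proportional to `k` is dominated by `exp (k R)`. -/
lemma linear_le_exp {A R D₀ k₀ k : ℝ} (hD₀ : 0 < D₀) (hk₀ : 0 ≤ k₀) (hR : D₀ ≤ R)
    (hA : D₀ * A ≤ R ^ 2) (hk : k = 1 + 34560 * (1 + k₀) / D₀ ^ 2 + 3 / D₀) :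
    960 * (A + (k₀ + 2 * k) * R) ≤ Real.exp (k * R) := by
  have hR0 : 0 < R := hD₀.trans_le hR
  have hk1 : 1 ≤ k := by
    rw [hk]
    have h1 : 0 ≤ 34560 * (1 + k₀) / D₀ ^ 2 := by positivity
    have h2 : 0 ≤ 3 / D₀ := by positivity
    linarith
  have hk2 : 34560 * (1 + k₀) ≤ k * D₀ ^ 2 := by
    have h2 : 0 ≤ 3 / D₀ := by positivity
    have h3 : 34560 * (1 + k₀) / D₀ ^ 2 ≤ k := by rw [hk]; linarith
    rwa [div_le_iff₀ (by positivity)] at h3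
  have hexp : (k * R) ^ 3 / 6 ≤ Real.exp (k * R) := by
    have := Real.pow_div_factorial_le_exp (k * R) (by positivity) 3
    simpa [Nat.factorial] using this
  refine le_trans ?_ hexp
  have hk3 : k ≤ k ^ 3 := le_self_pow₀ hk1 (by norm_num)
  have hk4 : k ^ 2 ≤ k ^ 3 := pow_le_pow_right₀ hk1 (by norm_num)
  have b0 : D₀ ^ 2 * R ≤ R ^ 3 := by
    have : D₀ ^ 2 ≤ R ^ 2 := pow_le_pow_left₀ hD₀.le hR 2
    nlinarith
  have b1 : D₀ ^ 2 * A ≤ R ^ 3 := by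
    have h1 := mul_le_mul_of_nonneg_left hA hD₀.le
    have h2 := mul_le_mul_of_nonneg_right hR (sq_nonneg R)
    linarith
  have hD2 : 0 < D₀ ^ 2 := by positivity
  have key : D₀ ^ 2 * (A + (k₀ + 2 * k) * R) ≤ (1 + k₀ + 2 * k) * R ^ 3 := by
    have : (k₀ + 2 * k) * (D₀ ^ 2 * R) ≤ (k₀ + 2 * k) * R ^ 3 :=
      mul_le_mul_of_nonneg_left b0 (by positivity)
    linarith
  have hpoly : 5760 * (1 + k₀ + 2 * k) ≤ D₀ ^ 2 * k ^ 3 := by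
    have h1 : 34560 * (1 + k₀) * k ≤ k * D₀ ^ 2 * k :=
      mul_le_mul_of_nonneg_right hk2 (by positivity)
    have h2 : D₀ ^ 2 * k ^ 2 ≤ D₀ ^ 2 * k ^ 3 := mul_le_mul_of_nonneg_left hk4 hD2.le
    have h3 : (1 + k₀) * 1 ≤ (1 + k₀) * k := mul_le_mul_of_nonneg_left hk1 (by positivity)
    have h4 : k ≤ (1 + k₀) * k := le_mul_of_one_le_left (by positivity) (by linarith)
    nlinarith
  have h5 : 5760 * (1 + k₀ + 2 * k) * R ^ 3 ≤ D₀ ^ 2 * k ^ 3 * R ^ 3 :=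
    mul_le_mul_of_nonneg_right hpoly (by positivity)
  have h6 : D₀ ^ 2 * (960 * (A + (k₀ + 2 * k) * R)) ≤ D₀ ^ 2 * ((k * R) ^ 3 / 6) := by
    nlinarith
  exact le_of_mul_le_mul_left h6 hD2

/-- Here `x` and `y` are the cube roots of `log B` and `log (1 / β)`, which turns the error term
into the polynomial `R = x ^ 2 y + y ^ 3`. The bound `D₀` below `y ^ 3` lets `R` absorb additive
constants. -/
lemma exists_parameters {D₀ : ℝ} (hD₀ : 0 < D₀) : ∃ K : ℝ, 0 < K ∧
    ∀ x y C : ℝ, 0 < x → 0 < y → D₀ ≤ y ^ 3 → 0 < C → C ≤ 4 →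
      ∃ S : Parameters (x ^ 3) (y ^ 3) C,
        ((S.T + 2 * S.N : ℕ) : ℝ) * C ≤ x ^ 3 + K * (x ^ 2 * y + y ^ 3) := by
  -- `M` pays for the factor `1 / 10` left to each of the ten bad events.
  set M := Real.log 10 / D₀ with hM
  have hM0 : 0 ≤ M := div_nonneg (Real.log_nonneg (by norm_num)) hD₀.le
  -- The summands cover the rate loss `288 t x ^ 3`, the doubled `2 dev + thr` without its `k R`
  -- part, the two tests, and the rounding errors, at most `16` because `C ≤ 4`.
  set k₀ := 1 + 2 * (1152 * (1 + M) + 1) + 64 * (1 + M) + 16 / D₀ with hk₀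
  have hk₀0 : 0 ≤ k₀ := by positivity
  -- The threshold contains `k R`, yet must dominate the logarithm of a flip count that itself
  -- involves `k`; a large `k` works because the exponential beats the linear count. The term `3 /
  -- D₀` ensures `3 ≤ thr`.
  set k := 1 + 34560 * (1 + k₀) / D₀ ^ 2 + 3 / D₀ with hk
  have hk0 : 0 < k := by positivity
  refine ⟨k₀ + 2 * k, by positivity, fun x y C hx hy hD hC0 hC4 => ?_⟩
  set R := x ^ 2 * y + y ^ 3 with hR
  have hR0 : 0 < R := by positivity
  have hyR : y ^ 3 ≤ R := by rw [hR]; nlinarith [mul_pos (pow_pos hx 2) hy]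
  have hDR : D₀ ≤ R := hD.trans hyR
  have hAR : D₀ * x ^ 3 ≤ R ^ 2 := by
    have h1 : D₀ * x ^ 3 ≤ y ^ 3 * x ^ 3 := mul_le_mul_of_nonneg_right hD (by positivity)
    have h2 : R ^ 2 - y ^ 3 * x ^ 3 = x ^ 2 * y ^ 2 * (x ^ 2 + 2 * y ^ 2 - x * y) + y ^ 6 := by
      rw [hR]; ring
    have h3 : 0 ≤ x ^ 2 + 2 * y ^ 2 - x * y := by nlinarith [sq_nonneg (x - y)]
    have h4 : 0 ≤ R ^ 2 - y ^ 3 * x ^ 3 := by rw [h2]; positivity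
    linarith
  have hxy : x * y ^ 2 + y ^ 3 ≤ 2 * R := by
    have : 2 * R - (x * y ^ 2 + y ^ 3) = y * (2 * x ^ 2 + y ^ 2 - x * y) := by rw [hR]; ring
    have h3 : 0 ≤ 2 * x ^ 2 + y ^ 2 - x * y := by nlinarith [sq_nonneg (x - y)]
    nlinarith [mul_nonneg hy.le h3]
  have hlog : Real.log 10 ≤ M * y ^ 3 := by
    rw [hM, div_mul_eq_mul_div, le_div_iff₀ hD₀]
    exact mul_le_mul_of_nonneg_left hD (Real.log_nonneg (by norm_num))
  -- The rate loss `t x ^ 3` is of order at most `x ^ 2 y`, while the deviation, of order `y ^ 3 /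
  -- t`, is of order `x y ^ 2 + y ^ 3`; both are `O(R)`. The factor `1 / 288` keeps `144 t ≤ 1 / 2`,
  -- so that `1 / (1 - 144 t) ≤ 1 + 288 t`.
  set t := 1 / 288 * (y / (x + y)) with ht
  set dev := 288 * (1 + M) * (x * y ^ 2 + y ^ 3) with hdev
  set thr := y ^ 3 + k * R with hthr
  have ht0 : 0 < t := by positivity
  have ht1 : t ≤ 1 / 288 := by
    have : y / (x + y) ≤ 1 := (div_le_one (by positivity)).2 (by linarith)
    linarith
  have htdev : t * dev = (1 + M) * y ^ 3 := by
    rw [ht, hdev]; field_simp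
  have htA : 288 * t * x ^ 3 ≤ R := by
    have h1 : 288 * t * x ^ 3 = y * x ^ 3 / (x + y) := by rw [ht]; ring
    rw [h1, div_le_iff₀ (by positivity), hR]
    have : (x ^ 2 * y + y ^ 3) * (x + y) - y * x ^ 3 = x ^ 2 * y ^ 2 + y ^ 3 * (x + y) := by ring
    have h2 : 0 ≤ x ^ 2 * y ^ 2 + y ^ 3 * (x + y) := by positivity
    linarith
  set rate := C * (1 - 144 * t) with hrate
  have hrate0 : 0 < rate := mul_pos hC0 (by linarith)
  set X := x ^ 3 + 2 * dev + thr with hX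
  have hX0 : 0 < X := by positivity
  set T := ⌈X / rate⌉₊ + 1 with hT
  set N := ⌈32 * ((1 + M) * y ^ 3) / C⌉₊ with hN
  have hlen : X < rate * T := by
    have h1 := Nat.le_ceil (X / rate)
    rw [div_le_iff₀ hrate0] at h1
    rw [hT]; push_cast
    linarith
  have hNle : (1 + M) * y ^ 3 ≤ N * (C / 32) := by
    have h1 := Nat.le_ceil (32 * ((1 + M) * y ^ 3) / C)
    rw [div_le_iff₀ hC0] at h1
    rw [hN]
    linarith
  have hTC : T * C ≤ X * (1 + 288 * t) + 8 := by
    have h1 := (Nat.ceil_lt_add_one (div_pos hX0 hrate0).le).le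
    have h2 : (T : ℝ) ≤ X / rate + 2 := by rw [hT]; push_cast; linarith
    have h3 : X / rate * C = X / (1 - 144 * t) := by
      have : (1 - 144 * t) ≠ 0 := by linarith
      rw [hrate]; field_simp
    have h4 : X / (1 - 144 * t) ≤ X * (1 + 288 * t) := by
      rw [div_le_iff₀ (by linarith), mul_assoc]
      refine le_mul_of_one_le_right hX0.le ?_
      nlinarith
    have h5 := mul_le_mul_of_nonneg_right h2 hC0.le
    linarith
  have hNC : N * C ≤ 32 * ((1 + M) * y ^ 3) + 4 := by
    have h1 := (Nat.ceil_lt_add_one (a := 32 * ((1 + M) * y ^ 3) / C) (by positivity)).le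
    have h2 := mul_le_mul_of_nonneg_right h1 hC0.le
    rw [add_mul (32 * ((1 + M) * y ^ 3) / C), div_mul_cancel₀ _ hC0.ne'] at h2
    rw [hN]
    linarith
  have hY : 2 * dev + thr ≤ (1152 * (1 + M) + 1 + k) * R := by
    have : 288 * (1 + M) * (x * y ^ 2 + y ^ 3) ≤ 288 * (1 + M) * (2 * R) :=
      mul_le_mul_of_nonneg_left hxy (by positivity)
    rw [hdev, hthr]
    linarith
  have hflips : ((T + 2 * N : ℕ) : ℝ) * C ≤ x ^ 3 + (k₀ + 2 * k) * R := by
    have hY0 : 0 ≤ 2 * dev + thr := by positivity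
    have h1 : X * (1 + 288 * t) ≤ x ^ 3 + R + 2 * (2 * dev + thr) := by
      have : (2 * dev + thr) * (1 + 288 * t) ≤ (2 * dev + thr) * 2 :=
        mul_le_mul_of_nonneg_left (by linarith) hY0
      have e : X * (1 + 288 * t) = x ^ 3 + 288 * t * x ^ 3 + (2 * dev + thr) * (1 + 288 * t) := by
        rw [hX]; ring
      linarith
    have h2 : (1 + M) * y ^ 3 ≤ (1 + M) * R := mul_le_mul_of_nonneg_left hyR (by positivity)
    have h3 : 16 ≤ 16 / D₀ * R := by
      rw [div_mul_eq_mul_div, le_div_iff₀ hD₀]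
      linarith
    push_cast
    rw [hk₀]
    linarith
  have hthr3 : 3 ≤ thr := by
    have h1 : 3 / D₀ ≤ k := by
      have : 0 ≤ 34560 * (1 + k₀) / D₀ ^ 2 := by positivity
      rw [hk]; linarith
    rw [div_le_iff₀ hD₀] at h1
    have h2 : k * D₀ ≤ k * R := mul_le_mul_of_nonneg_left hDR hk0.le
    have h3 : 0 < y ^ 3 := by positivity
    rw [hthr]; linarith
  have hpen := exp_le_two_mul_penalty hthr3
  have hpen0 : 0 < penalty thr := by
    have := Real.exp_pos thr
    linarith
  refine ⟨⟨t, dev, thr, T, N, ht0, ht1, hlen, exp_neg_le_div_ten hlog htdev.ge,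
    exp_neg_le_div_ten hlog hNle, hpen0, ?_⟩, hflips⟩
  rw [div_le_iff₀ hpen0]
  -- The constant `960` there is `48 * 10 * 2`: the drift, the share `1 / 10` of the failure
  -- probability, and the loss in `exp_le_two_mul_penalty`.
  have h1 := linear_le_exp hD₀ hk₀0 hDR hAR hk
  have h2 : Real.exp (k * R) = Real.exp (-y ^ 3) * Real.exp thr := by
    rw [← Real.exp_add, hthr]; ring_nf
  have h3 : Real.exp (-y ^ 3) * Real.exp thr ≤ Real.exp (-y ^ 3) * (2 * penalty thr) :=
    mul_le_mul_of_nonneg_left hpen (Real.exp_pos _).le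
  linarith

/-! ### Upper bounds on the number of flips -/

lemma exists_solves_of_parameters {B : ℕ} (hB : 0 < B) {τ α c A D : ℝ} (hτ0 : 0 < τ) (hτ1 : τ < 1)
    (hα : 0 < α) (hατ : α ≤ 1 / 2 * min τ (1 - τ)) (hc0 : 0 ≤ c) (hc1 : c ≤ 1)
    (hA : Real.log B = A) (S : Parameters A D (capacity τ α)) :
    ∃ A : Algorithm B, A.flips = S.T + 2 * S.N ∧ A.Solves τ α c (Real.exp (-D)) := by
  subst hA
  obtain ⟨⟨s, hs⟩, -, -⟩ := exists_channel hτ0 hτ1 hα hατ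
  obtain ⟨hlo, hhi⟩ := mul_one_add_le_of_le_half_min hα hατ hc1
  let P : Config := ⟨τ - α, τ + α, s, capacity τ α * (1 - 144 * S.t), S.dev, S.thr, B, S.T, S.N⟩
  have hP : P.Valid := ⟨hs.a_pos, hs.a_lt, hs.lt_b, hs.b_lt,
    mul_nonneg hs.C_pos.le (by linarith [S.t_le]), hB⟩
  refine ⟨P.algorithm hP.B_pos, rfl,
    solves_of_prob_le _ (Real.exp_pos _).le fun p hp adv hadv => ?_⟩
  obtain ⟨l, r, hlr, hr, hlow, hhigh, hgood⟩ := exists_good_interval hp hα hc0 hlo hhi hadv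
  obtain ⟨W, hW, hans⟩ := P.exists_bad_set (adv := adv) (l := l) (r := r) hP ⟨hlow, hhigh⟩ hs hlr hr
    S.t_pos (by linarith [S.t_le]) rfl S.length S.deviation S.tests S.penalty_pos S.certificates
  refine ⟨W, hW, fun h hh hhW => ?_⟩
  obtain ⟨h1, h2⟩ := hans h hh hhW
  have h3 : min (P.answer h) (P.B - 1) = P.answer h := min_eq_left (Nat.le_sub_one_of_lt
    (h2.trans_lt hr))
  refine hgood _ ?_ ?_
  · change l ≤ min (P.answer h) (P.B - 1)
    rwa [h3]
  · change min (P.answer h) (P.B - 1) ≤ r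
    rwa [h3]

lemma rpow_one_third_pow_three {x : ℝ} (hx : 0 ≤ x) : (x ^ (1 / 3 : ℝ)) ^ 3 = x := by
  rw [← Real.rpow_natCast, ← Real.rpow_mul hx]
  norm_num

lemma rpow_one_third_sq {x : ℝ} (hx : 0 ≤ x) : (x ^ (1 / 3 : ℝ)) ^ 2 = x ^ (2 / 3 : ℝ) := by
  rw [← Real.rpow_natCast, ← Real.rpow_mul hx]
  norm_num

/-- Adversarial monotonic noisy binary search at the rate given by the capacity. -/
theorem exists_solves_capacity (β₀ : ℝ) (hβ₀ : β₀ < 1) : ∃ K : ℝ, 0 < K ∧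
    ∀ (B : ℕ) (τ α c β : ℝ), 1 ≤ B → 0 < τ → τ < 1 →
      0 < α → α ≤ 1 / 2 * min τ (1 - τ) → 0 ≤ c → c ≤ 1 → 0 < β → β ≤ β₀ →
      ∃ A : Algorithm B,
        (A.flips : ℝ) ≤ 1 / capacity τ α *
          (Real.log B + K * (Real.log B ^ (2 / 3 : ℝ) * Real.log (1 / β) ^ (1 / 3 : ℝ)
            + Real.log (1 / β))) ∧
        A.Solves τ α c β := by
  rcases le_or_gt β₀ 0 with h0 | h0
  · exact ⟨1, one_pos, fun _ _ _ _ _ _ _ _ _ _ _ _ hβ hβ' => absurd (hβ.trans_le hβ') h0.not_gt⟩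
  obtain ⟨K, hK, H⟩ := exists_parameters (Real.log_pos (one_lt_one_div h0 hβ₀))
  refine ⟨K, hK, fun B τ α c β hB hτ0 hτ1 hα hατ hc0 hc1 hβ hββ₀ => ?_⟩
  obtain ⟨⟨s, hs⟩, -, -⟩ := exists_channel hτ0 hτ1 hα hατ
  have hD : Real.log (1 / β₀) ≤ Real.log (1 / β) :=
    Real.log_le_log (by positivity) (one_div_le_one_div_of_le hβ hββ₀)
  have hD0 : 0 < Real.log (1 / β) := (Real.log_pos (one_lt_one_div h0 hβ₀)).trans_le hD
  rcases hB.eq_or_lt with rfl | hB2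
  · obtain ⟨A, hA, hA'⟩ := exists_solves_one hα hατ hc0 hc1 hβ.le
    refine ⟨A, ?_, hA'⟩
    have := hs.C_pos
    rw [hA, Nat.cast_one, Real.log_one]
    push_cast
    positivity
  have hA0 : 0 < Real.log B := Real.log_pos (by exact_mod_cast hB2)
  obtain ⟨S, hS⟩ := H (Real.log B ^ (1 / 3 : ℝ)) (Real.log (1 / β) ^ (1 / 3 : ℝ)) (capacity τ α)
    (by positivity) (by positivity) (by rwa [rpow_one_third_pow_three hD0.le]) hs.C_pos hs.C_le
  obtain ⟨A, hA, hA'⟩ := exists_solves_of_parameters (by omega) hτ0 hτ1 hα hατ hc0 hc1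
    (rpow_one_third_pow_three hA0.le).symm S
  refine ⟨A, ?_, ?_⟩
  · rw [← hA, rpow_one_third_pow_three hD0.le, rpow_one_third_pow_three hA0.le,
      rpow_one_third_sq hA0.le] at hS
    rwa [one_div_mul_eq_div, le_div_iff₀ hs.C_pos]
  · rwa [rpow_one_third_pow_three hD0.le, one_div, Real.log_inv, neg_neg, Real.exp_log hβ] at hA'

/-- Adversarial monotonic noisy binary search for fair coins, with high probability. -/
theorem exists_solves_half (l : ℝ) (hl : 0 < l) : ∃ K : ℝ, 0 < K ∧
    ∀ (B : ℕ) (α c : ℝ), 1 ≤ B → 0 < α → α ≤ 1 / 4 → 0 ≤ c → c ≤ 1 →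
      ∃ A : Algorithm B,
        (A.flips : ℝ) ≤ K * (Real.log B / α ^ 2) ∧
        A.Solves (1 / 2) α c ((B : ℝ) ^ (-l)) := by
  -- For `B ≥ 2` the failure probability is at most `2 ^ (-l) < 1`; `B = 1` needs no flips.
  obtain ⟨K, hK, H⟩ := exists_solves_capacity ((2 : ℝ) ^ (-l))
    (Real.rpow_lt_one_of_one_lt_of_neg (by norm_num) (by linarith))
  refine ⟨3 / 2 * (1 + K * (l ^ (1 / 3 : ℝ) + l)), by positivity,
    fun B α c hB hα hα4 hc0 hc1 => ?_⟩
  have hατ : α ≤ 1 / 2 * min (1 / 2) (1 - 1 / 2) := by norm_num; linarith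
  rcases hB.eq_or_lt with rfl | hB2
  · obtain ⟨A, hA, hA'⟩ := exists_solves_one hα hατ hc0 hc1
      (Real.rpow_nonneg (Nat.cast_nonneg 1) (-l))
    exact ⟨A, by simp [hA], hA'⟩
  have hB2' : (2 : ℝ) ≤ B := by exact_mod_cast hB2
  have hB0 : (0 : ℝ) < B := by linarith
  have hA0 : 0 < Real.log B := Real.log_pos (by linarith)
  obtain ⟨A, hA, hA'⟩ := H B (1 / 2) α c ((B : ℝ) ^ (-l)) hB (by norm_num) (by norm_num) hα hατ
    hc0 hc1 (by positivity) (Real.rpow_le_rpow_of_nonpos (by norm_num) hB2' (by linarith))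
  refine ⟨A, hA.trans ?_, hA'⟩
  obtain ⟨⟨s, hs⟩, hcap, -⟩ := exists_channel (τ := 1 / 2) (by norm_num) (by norm_num) hα hατ
  have hD : Real.log (1 / (B : ℝ) ^ (-l)) = l * Real.log B := by
    rw [one_div, Real.log_inv, Real.log_rpow hB0]
    ring
  have hR : Real.log B ^ (2 / 3 : ℝ) * (l * Real.log B) ^ (1 / 3 : ℝ)
      = l ^ (1 / 3 : ℝ) * Real.log B := by
    rw [Real.mul_rpow hl.le hA0.le, mul_left_comm, ← Real.rpow_add hA0]
    norm_num
  have hcap' : 1 / capacity (1 / 2) α ≤ 3 / 2 / α ^ 2 := by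
    rw [div_le_div_iff₀ hs.C_pos (by positivity)]
    norm_num at hcap
    linarith
  rw [hD, hR]
  have h1 : 0 ≤ Real.log B + K * (l ^ (1 / 3 : ℝ) * Real.log B + l * Real.log B) := by positivity
  refine (mul_le_mul_of_nonneg_right hcap' h1).trans_eq ?_
  ring

end AdvNBS

end

theorem theorem5 :
    -- target `1/2`, with high probability in `B`
    (∀ l : ℝ, 0 < l → ∃ K : ℝ, 0 < K ∧
      ∀ (B : ℕ) (α c : ℝ), 1 ≤ B → 0 < α → α ≤ 1 / 4 → 0 ≤ c → c ≤ 1 →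
        ∃ A : AdvNBS.Algorithm B,
          (A.flips : ℝ) ≤ K * (Real.log B / α ^ 2) ∧
          A.Solves (1 / 2) α c ((B : ℝ) ^ (-l))) ∧
    -- general target `τ` and failure probability `β`, for `β` bounded away from `1`
    (∀ β₀ : ℝ, β₀ < 1 → ∃ K : ℝ, 0 < K ∧
      ∀ (B : ℕ) (τ α c β : ℝ), 1 ≤ B → 0 < τ → τ < 1 →
        0 < α → α ≤ 1 / 2 * min τ (1 - τ) → 0 ≤ c → c ≤ 1 → 0 < β → β ≤ β₀ →
        ∃ A : AdvNBS.Algorithm B,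
          (A.flips : ℝ) ≤ 1 / AdvNBS.capacity τ α *
            (Real.log B + K * (Real.log B ^ (2 / 3 : ℝ) * Real.log (1 / β) ^ (1 / 3 : ℝ)
              + Real.log (1 / β))) ∧
          A.Solves τ α c β) ∧
    -- the order of magnitude of the capacity
    (∃ k₁ k₂ : ℝ, 0 < k₁ ∧ 0 < k₂ ∧
      ∀ τ α : ℝ, 0 < τ → τ < 1 → 0 < α → α ≤ 1 / 2 * min τ (1 - τ) →
        k₁ * (α ^ 2 / (τ * (1 - τ))) ≤ AdvNBS.capacity τ α ∧
        AdvNBS.capacity τ α ≤ k₂ * (α ^ 2 / (τ * (1 - τ)))) := by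
  refine ⟨AdvNBS.exists_solves_half, AdvNBS.exists_solves_capacity,
    1 / 6, 16, by norm_num, by norm_num, fun τ α hτ0 hτ1 hα hατ => ?_⟩
  exact (AdvNBS.exists_channel hτ0 hτ1 hα hατ).2
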